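/- Let $(X,Y)$ be a random vector in $\mathbb R^2$ with continuous joint distribution function and let $(X_1,Y_1),(X_2,Y_2),\dots$ be i.i.d. copies of $(X,Y)$. Let $C$ be the copula of $(X,Y)$, i.e. the copula with $\mathbb P(X\le x,Y\le y)=C(\mathbb P(X\le x),\mathbb P(Y\le y))$ for all $x,y\in\mathbb R$, and let $$\xi(Y|X)=\xi(C)=6\int_{[0,1]^2}\bigl(\partial_1C(u,v)\bigr)^2\,\mathrm d\lambda^2(u,v)-2$$ be Chatterjee's xi. For $\kappa\in[0,1/3]$ and $n\ge 1$ put $m=\lfloor n^\kappa\rfloor$. For real vectors $x=(x_1,\dots,x_n)$ and $y=(y_1,\dots,y_n)$ let $u_k=\frac1{n+1}\#\{j: x_j\le x_k\}$ and $v_k=\frac1{n+1}\#\{j: y_j\le y_k\}$ be the normalized ranks, and let $\Delta$ be the empirical checkerboard matrix $$\Delta_{i,j}=\frac1n\sum_{k=1}^n \mathbf 1\Bigl\{(u_k,v_k)\in\bigl[\tfrac{i-1}m,\tfrac im\bigr)\times\bigl[\tfrac{j-1}m,\tfrac jm\bigr)\Bigr\},\qquad 1\le i,j\le m.$$ With the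 $m\times m$ matrices $T_{i,j}=\mathbf 1\{i<j\}$ and $M_\xi=TT^\top+T^\top+\tfrac13I_m$, define $$\xi_n^\kappa(x,y)=6\,\mathrm{tr}\bigl(\Delta^\top\Delta M_\xi\bigr)+\tfrac12\,\mathrm{tr}\bigl(\Delta^\top\Delta\bigr)-2,$$ which is the arithmetic mean of the checkerboard value $6\,\mathrm{tr}(\Delta^\top\Delta M_\xi)-2$ and the check–min value $6\,\mathrm{tr}(\Delta^\top\Delta M_\xi)+\mathrm{tr}(\Delta^\top\Delta)-2$. **Theorem.** Let $0\le\kappa\le\frac13$. 1. $\xi_n^\kappa$ can be computed in time $O(n\log n)$: there is a program for a real random access machine which, for every $n\ge1$ and all $x,y\in\mathbb R^n$, on input $(n,\kappa,x,y)$ outputs $\xi_n^\kappa(x,y)$ after at most $T(n)$ steps, where $T(n)=O(n\log n)$. (The machine has registers and arrays of natural numbers, with addition, truncated subtraction and comparison, and registers and arrays of real numbers, with $+,-,\times,\div$, powers and comparison; natural numbers can be converted to reals but not conversely; every elementary operation, memory access, test and control step has unit cost.) 2. If $\kappa>0$, then $\xi_n^\kappa\bigl((X_1,\dots,X_n),(Y_1,\dots,Y_n)\bigr)\to\xi(Y|X)$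 almost surely as $n\to\infty$. -/

import Mathlib

open MeasureTheory ProbabilityTheory Filter Topology

universe u

/-! ## Copulas and Chatterjee's xi -/

/-- Bivariate copulas. A copula is a function on the unit square; only the values on
`[0,1] × [0,1]` of the function `C` matter. -/
structure IsCopula (C : ℝ → ℝ → ℝ) : Prop where
  mem_unit : ∀ u ∈ Set.Icc (0 : ℝ) 1, ∀ v ∈ Set.Icc (0 : ℝ) 1, C u v ∈ Set.Icc (0 : ℝ) 1
  grounded_left : ∀ v ∈ Set.Icc (0 : ℝ) 1, C 0 v = 0
  grounded_right : ∀ u ∈ Set.Icc (0 : ℝ) 1, C u 0 = 0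
  margin_left : ∀ u ∈ Set.Icc (0 : ℝ) 1, C u 1 = u
  margin_right : ∀ v ∈ Set.Icc (0 : ℝ) 1, C 1 v = v
  two_increasing : ∀ u₁ v₁ u₂ v₂ : ℝ, 0 ≤ u₁ → u₁ ≤ v₁ → v₁ ≤ 1 → 0 ≤ u₂ → u₂ ≤ v₂ → v₂ ≤ 1 →
    0 ≤ C v₁ v₂ - C u₁ v₂ - C v₁ u₂ + C u₁ u₂

/-- The joint distribution function of a law on the plane. -/
noncomputable def jointCdf (μ : Measure (ℝ × ℝ)) (p : ℝ × ℝ) : ℝ :=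
  μ.real (Set.Iic p.1 ×ˢ Set.Iic p.2)

/-- `C` is a copula of the law `μ` of a random vector `(X, Y)`: it couples the two marginal
distribution functions to the joint one, `F (x, y) = C (F₁ x, F₂ y)`. -/
structure IsCopulaOf (C : ℝ → ℝ → ℝ) (μ : Measure (ℝ × ℝ)) : Prop where
  isCopula : IsCopula C
  sklar : ∀ x y : ℝ, jointCdf μ (x, y) = C (cdf μ.fst x) (cdf μ.snd y)

/-- Chatterjee's xi of a copula, `ξ(C) = 6 ∫ (∂₁ C)² - 2` over the unit square. A copula is
monotone and Lipschitz in its first argument, so `∂₁ C` exists almost everywhere. -/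
noncomputable def chatterjeeXi (C : ℝ → ℝ → ℝ) : ℝ :=
  6 * (∫ p in Set.Icc (0 : ℝ) 1 ×ˢ Set.Icc (0 : ℝ) 1, (deriv (fun s => C s p.2) p.1) ^ 2) - 2

/-! ## The checkerboard estimator -/

/-- The rank of the `k`-th entry: the number of `j` with `x j ≤ x k`. -/
noncomputable def sampleRank {n : ℕ} (x : Fin n → ℝ) (k : Fin n) : ℕ :=
  (Finset.univ.filter fun j => x j ≤ x k).card

/-- The rank-transformed sample point, normalized to lie in `(0, 1)`. -/
noncomputable def pseudoObs {n : ℕ} (x : Fin n → ℝ) (k : Fin n) : ℝ :=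
  (sampleRank x k : ℝ) / ((n : ℝ) + 1)

/-- The `(i, j)`-th square of the partition of the unit square into `m × m` half-open squares of
equal size (`i` and `j` start at `0`). -/
def gridSquare (m : ℕ) (i j : Fin m) : Set (ℝ × ℝ) :=
  Set.Ico ((i : ℝ) / m) (((i : ℝ) + 1) / m) ×ˢ Set.Ico ((j : ℝ) / m) (((j : ℝ) + 1) / m)

/-- The empirical `m × m` checkerboard matrix: relative frequencies of the rank-transformed sample
points in the squares of the grid. -/
noncomputable def empiricalCheckerboard {n : ℕ} (m : ℕ) (x y : Fin n → ℝ) :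
    Matrix (Fin m) (Fin m) ℝ :=
  Matrix.of fun i j =>
    (1 / (n : ℝ)) * ∑ k : Fin n, (gridSquare m i j).indicator 1 (pseudoObs x k, pseudoObs y k)

/-- The strictly upper triangular matrix of ones. -/
def upperOnes (m : ℕ) : Matrix (Fin m) (Fin m) ℝ :=
  Matrix.of fun i j => if i < j then 1 else 0

/-- The matrix `M_ξ = T Tᵀ + Tᵀ + (1/3) I`. -/
noncomputable def xiMatrix (m : ℕ) : Matrix (Fin m) (Fin m) ℝ :=
  upperOnes m * (upperOnes m).transpose + (upperOnes m).transpose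
    + (1 / 3 : ℝ) • (1 : Matrix (Fin m) (Fin m) ℝ)

/-- The value `6 tr(Δᵀ Δ M_ξ) + (1/2) tr(Δᵀ Δ) - 2`, the arithmetic mean of the checkerboard value
`6 tr(Δᵀ Δ M_ξ) - 2` and the check-min value `6 tr(Δᵀ Δ M_ξ) + tr(Δᵀ Δ) - 2`. -/
noncomputable def xiOfMatrix {m : ℕ} (D : Matrix (Fin m) (Fin m) ℝ) : ℝ :=
  6 * (D.transpose * D * xiMatrix m).trace + (1 / 2) * (D.transpose * D).trace - 2

/-- The estimator with grid size `⌊n ^ κ⌋`. -/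
noncomputable def xiEstimator (κ : ℝ) {n : ℕ} (x y : Fin n → ℝ) : ℝ :=
  xiOfMatrix (empiricalCheckerboard ⌊(n : ℝ) ^ κ⌋₊ x y)

/-! ## A real random access machine with a step count

There are registers and arrays for natural numbers (counters and array indices) and registers and
arrays for real numbers. Natural numbers can be added, subtracted (truncated at `0`) and compared;
reals can be added, subtracted, multiplied, divided, raised to a power and compared. A natural
number can be converted to a real number, but not conversely: in particular no rounding operation
is available. Every elementary operation, memory access, test and control step costs one unit. -/

/-- The memory. Registers and arrays are numbered, `intArr a i` is cell `i` of array `a`. A program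
mentions only finitely many registers and arrays. -/
structure Store where
  intReg : ℕ → ℕ
  realReg : ℕ → ℝ
  intArr : ℕ → ℕ → ℕ
  realArr : ℕ → ℕ → ℝ

/-- Expressions with natural number values. -/
inductive IntExpr : Type
  | lit (c : ℕ)
  | reg (r : ℕ)
  | read (a : ℕ) (i : IntExpr)
  | plus (e f : IntExpr)
  | minus (e f : IntExpr)

/-- Expressions with real values. -/
inductive RealExpr : Type
  | ofInt (e : IntExpr)
  | reg (r : ℕ)
  | read (a : ℕ) (i : IntExpr)
  | plus (e f : RealExpr)
  | minus (e f : RealExpr)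
  | times (e f : RealExpr)
  | over (e f : RealExpr)
  | power (e f : RealExpr)

/-- Tests. -/
inductive BoolExpr : Type
  | intLe (e f : IntExpr)
  | realLe (e f : RealExpr)
  | neg (b : BoolExpr)
  | both (b c : BoolExpr)

/-- Programs. -/
inductive Prog : Type
  | skip
  | setInt (r : ℕ) (e : IntExpr)
  | setReal (r : ℕ) (e : RealExpr)
  | writeInt (a : ℕ) (i e : IntExpr)
  | writeReal (a : ℕ) (i : IntExpr) (e : RealExpr)
  | seq (p q : Prog)
  | branch (b : BoolExpr) (p q : Prog)
  | loop (b : BoolExpr) (p : Prog)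

def IntExpr.val (s : Store) : IntExpr → ℕ
  | .lit c => c
  | .reg r => s.intReg r
  | .read a i => s.intArr a (i.val s)
  | .plus e f => e.val s + f.val s
  | .minus e f => e.val s - f.val s

def IntExpr.cost : IntExpr → ℕ
  | .lit _ => 1
  | .reg _ => 1
  | .read _ i => i.cost + 1
  | .plus e f => e.cost + f.cost + 1
  | .minus e f => e.cost + f.cost + 1

noncomputable def RealExpr.val (s : Store) : RealExpr → ℝ
  | .ofInt e => (e.val s : ℝ)
  | .reg r => s.realReg r
  | .read a i => s.realArr a (i.val s)
  | .plus e f => e.val s + f.val s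
  | .minus e f => e.val s - f.val s
  | .times e f => e.val s * f.val s
  | .over e f => e.val s / f.val s
  | .power e f => e.val s ^ f.val s

def RealExpr.cost : RealExpr → ℕ
  | .ofInt e => e.cost + 1
  | .reg _ => 1
  | .read _ i => i.cost + 1
  | .plus e f => e.cost + f.cost + 1
  | .minus e f => e.cost + f.cost + 1
  | .times e f => e.cost + f.cost + 1
  | .over e f => e.cost + f.cost + 1
  | .power e f => e.cost + f.cost + 1

def BoolExpr.Holds (s : Store) : BoolExpr → Prop
  | .intLe e f => e.val s ≤ f.val s
  | .realLe e f => e.val s ≤ f.val s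
  | .neg b => ¬ b.Holds s
  | .both b c => b.Holds s ∧ c.Holds s

def BoolExpr.cost : BoolExpr → ℕ
  | .intLe e f => e.cost + f.cost + 1
  | .realLe e f => e.cost + f.cost + 1
  | .neg b => b.cost + 1
  | .both b c => b.cost + c.cost + 1

def Store.setIntReg (s : Store) (r v : ℕ) : Store :=
  { s with intReg := Function.update s.intReg r v }

def Store.setRealReg (s : Store) (r : ℕ) (v : ℝ) : Store :=
  { s with realReg := Function.update s.realReg r v }

def Store.setIntCell (s : Store) (a i v : ℕ) : Store :=
  { s with intArr := Function.update s.intArr a (Function.update (s.intArr a) i v) }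

def Store.setRealCell (s : Store) (a i : ℕ) (v : ℝ) : Store :=
  { s with realArr := Function.update s.realArr a (Function.update (s.realArr a) i v) }

/-- `Exec p s s' t`: the program `p`, started in the memory `s`, halts in the memory `s'` after
exactly `t` steps. -/
inductive Exec : Prog → Store → Store → ℕ → Prop
  | skip (s : Store) : Exec .skip s s 1
  | setInt (s : Store) (r : ℕ) (e : IntExpr) :
      Exec (.setInt r e) s (s.setIntReg r (e.val s)) (e.cost + 1)
  | setReal (s : Store) (r : ℕ) (e : RealExpr) :
      Exec (.setReal r e) s (s.setRealReg r (e.val s)) (e.cost + 1)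
  | writeInt (s : Store) (a : ℕ) (i e : IntExpr) :
      Exec (.writeInt a i e) s (s.setIntCell a (i.val s) (e.val s)) (i.cost + e.cost + 1)
  | writeReal (s : Store) (a : ℕ) (i : IntExpr) (e : RealExpr) :
      Exec (.writeReal a i e) s (s.setRealCell a (i.val s) (e.val s)) (i.cost + e.cost + 1)
  | seq {p q : Prog} {s₁ s₂ s₃ : Store} {t₁ t₂ : ℕ} :
      Exec p s₁ s₂ t₁ → Exec q s₂ s₃ t₂ → Exec (.seq p q) s₁ s₃ (t₁ + t₂)
  | branchTrue {b : BoolExpr} {p q : Prog} {s s' : Store} {t : ℕ} :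
      b.Holds s → Exec p s s' t → Exec (.branch b p q) s s' (b.cost + 1 + t)
  | branchFalse {b : BoolExpr} {p q : Prog} {s s' : Store} {t : ℕ} :
      ¬ b.Holds s → Exec q s s' t → Exec (.branch b p q) s s' (b.cost + 1 + t)
  | loopFalse {b : BoolExpr} {p : Prog} {s : Store} :
      ¬ b.Holds s → Exec (.loop b p) s s (b.cost + 1)
  | loopTrue {b : BoolExpr} {p : Prog} {s₁ s₂ s₃ : Store} {t₁ t₂ : ℕ} :
      b.Holds s₁ → Exec p s₁ s₂ t₁ → Exec (.loop b p) s₂ s₃ t₂ →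
      Exec (.loop b p) s₁ s₃ (b.cost + 1 + t₁ + t₂)

/-- The memory at the start: integer register `0` holds the sample size, real register `0` holds
the exponent, real arrays `0` and `1` hold the two coordinates of the sample, and everything else
is zero. -/
noncomputable def initStore (κ : ℝ) {n : ℕ} (x y : Fin n → ℝ) : Store where
  intReg := fun r => if r = 0 then n else 0
  realReg := fun r => if r = 0 then κ else 0
  intArr := fun _ _ => 0
  realArr := fun a i =>
    if h : i < n then (if a = 0 then x ⟨i, h⟩ else if a = 1 then y ⟨i, h⟩ else 0) else 0

/-- The program `p`, started in the memory `s`, halts after at most `t` steps with the value `out`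
in real register `0`. -/
def Computes (p : Prog) (s : Store) (t : ℕ) (out : ℝ) : Prop :=
  ∃ (s' : Store) (t' : ℕ), Exec p s s' t' ∧ t' ≤ t ∧ s'.realReg 0 = out

/-!
The theorem has two independent parts.

*Running time.* If `S i j` is the sum of the entries `D i l` with `l < j`, then `D T = S`, and
cyclicity of the trace turns the estimator into `∑ (6 (S² + S D + D² / 3) + D² / 2) - 2`
(`xiOfMatrix_eq_sum`). Once the matrix is known, this takes `O(m²)` steps with running row sums, and
`m² ≤ n` because `κ ≤ 1 / 3` (`gridSize_sq_le`). The ranks come from a bottom-up merge sort of the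
indices, followed by a downward scan that treats ties correctly. The machine cannot round, so the cell
`⌊r m / (n + 1)⌋` of every rank `r` is tabulated in one sweep: because `m ≤ n`, it grows by at most one
from each rank to the next. Correctness and cost are proved together in a Hoare-style logic
(`Runs`), with weakest preconditions for loop-free code and indexed invariants for loops; the result
is `runs_xiProg`.

*Consistency.* In the same formula the row sums `S i j` are increments in the first argument of the
empirical copula of the normalized ranks. Suppose the empirical copula is uniformly within `δ` of `C`.
There are `m²` entries, each `S i j` is of order `1 / m`, and the terms containing `D` contribute at
most the order of a full row sum. Replacing `S i j` by the increment of `C` therefore costs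
`O(m δ + 1 / m)` as long as `m δ ≤ 1` (`abs_sum_xiTerm_sub_le`). The sum of squared increments of `C` converges to
`∫ (∂₁ C)²` (`IsCopula.tendsto_sum_sq_increments`): difference quotients over the grid cell containing
a point converge almost everywhere to the derivative, and as a function of the
second argument their mean square (`gridEnergy`) is monotone because `C` is two-increasing, so that its
Riemann sums are within `1 / m` of its integral.

It remains to see that `m δ → 0` almost surely. With `m ≤ n ^ (1/3)`, the rate `δ = O(n ^ (-2/5))` is
enough. Hoeffding's inequality and the Borel–Cantelli lemma give it for the frequencies of products of
quantile sets at the levels `a / n`, `b / n` (`ae_eventually_abs_freq_sub_lt`). Monotonicity of the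
distribution functions and the Lipschitz property of `C` then transfer it to the normalized ranks and
to the empirical copula (`abs_empiricalCopula_sub_le`). Continuity of the joint distribution function
is used to make the marginal distribution functions continuous, so that quantile sets exist at every
level.
-/

/-! ### A cost-aware program logic for the random access machine -/

/-- The program `p`, started in `s`, halts after at most `t` steps in a memory satisfying `Q`. -/
def Runs (p : Prog) (s : Store) (t : ℕ) (Q : Store → Prop) : Prop :=
  ∃ (s' : Store) (t' : ℕ), Exec p s s' t' ∧ t' ≤ t ∧ Q s'

theorem Runs.mono {p : Prog} {s : Store} {t t' : ℕ} {Q Q' : Store → Prop} (h : Runs p s t Q)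
    (ht : t ≤ t') (hQ : ∀ s', Q s' → Q' s') : Runs p s t' Q' := by
  obtain ⟨s', u, he, hu, hq⟩ := h
  exact ⟨s', u, he, hu.trans ht, hQ _ hq⟩

theorem Runs.seq {p q : Prog} {s : Store} {t₁ t₂ : ℕ} {R Q : Store → Prop} (hp : Runs p s t₁ R)
    (hq : ∀ s', R s' → Runs q s' t₂ Q) : Runs (.seq p q) s (t₁ + t₂) Q := by
  obtain ⟨s', u, he, hu, hr⟩ := hp
  obtain ⟨s'', u', he', hu', hr'⟩ := hq s' hr
  exact ⟨s'', u + u', .seq he he', by omega, hr'⟩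

/-- A loop with an invariant `I k` indexed by the number `k` of completed rounds. -/
theorem Runs.loop {b : BoolExpr} {p : Prog} (I : ℕ → Store → Prop) (N c : ℕ)
    (hstep : ∀ k < N, ∀ s, I k s → b.Holds s ∧ Runs p s c (I (k + 1)))
    (hend : ∀ s, I N s → ¬ b.Holds s) {s : Store} (h0 : I 0 s) :
    Runs (.loop b p) s (N * (b.cost + 1 + c) + (b.cost + 1)) (I N) := by
  have key : ∀ r k s, k + r = N → I k s →
      Runs (.loop b p) s (r * (b.cost + 1 + c) + (b.cost + 1)) (I N) := by
    intro r
    induction r with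
    | zero =>
      intro k s hk hI
      obtain rfl : k = N := by omega
      exact ⟨s, _, .loopFalse (hend s hI), by omega, hI⟩
    | succ r ih =>
      intro k s hk hI
      obtain ⟨hb, s', u, he, hu, hI'⟩ := hstep k (by omega) s hI
      obtain ⟨s'', u', he', hu', hI''⟩ := ih (k + 1) s' (by omega) hI'
      refine ⟨s'', _, .loopTrue hb he he', ?_, hI''⟩
      rw [Nat.succ_mul]
      omega
  exact key N 0 s (by omega) h0

/-- Weakest precondition of a loop-free program. -/
def Prog.wp : Prog → (Store → Prop) → Store → Prop
  | .skip, Q, s => Q s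
  | .setInt r e, Q, s => Q (s.setIntReg r (e.val s))
  | .setReal r e, Q, s => Q (s.setRealReg r (e.val s))
  | .writeInt a i e, Q, s => Q (s.setIntCell a (i.val s) (e.val s))
  | .writeReal a i e, Q, s => Q (s.setRealCell a (i.val s) (e.val s))
  | .seq p q, Q, s => p.wp (q.wp Q) s
  | .branch b p q, Q, s => (b.Holds s → p.wp Q s) ∧ (¬ b.Holds s → q.wp Q s)
  | .loop _ _, _, _ => False

/-- Worst-case cost of a loop-free program. -/
def Prog.maxCost : Prog → ℕ
  | .skip => 1
  | .setInt _ e => e.cost + 1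
  | .setReal _ e => e.cost + 1
  | .writeInt _ i e => i.cost + e.cost + 1
  | .writeReal _ i e => i.cost + e.cost + 1
  | .seq p q => p.maxCost + q.maxCost
  | .branch b p q => b.cost + 1 + (p.maxCost + q.maxCost)
  | .loop _ _ => 0

theorem Runs.of_wp {p : Prog} {s : Store} {Q : Store → Prop} (h : p.wp Q s) :
    Runs p s p.maxCost Q := by
  induction p generalizing s Q with
  | skip => exact ⟨s, 1, .skip s, le_rfl, h⟩
  | setInt r e => exact ⟨_, _, .setInt s r e, le_rfl, h⟩
  | setReal r e => exact ⟨_, _, .setReal s r e, le_rfl, h⟩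
  | writeInt a i e => exact ⟨_, _, .writeInt s a i e, le_rfl, h⟩
  | writeReal a i e => exact ⟨_, _, .writeReal s a i e, le_rfl, h⟩
  | seq p q hp hq => exact (hp h).seq fun s' hs' => hq hs'
  | branch b p q hp hq =>
    by_cases hb : b.Holds s
    · obtain ⟨s', u, he, hu, hr⟩ := hp (h.1 hb)
      exact ⟨s', _, .branchTrue hb he, by simp only [Prog.maxCost]; omega, hr⟩
    · obtain ⟨s', u, he, hu, hr⟩ := hq (h.2 hb)
      exact ⟨s', _, .branchFalse hb he, by simp only [Prog.maxCost]; omega, hr⟩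
  | loop b p _ => exact h.elim

/-- The program has an assignment to the natural number register `r`. -/
def Prog.WritesIntReg (r : ℕ) : Prog → Prop
  | .setInt r' _ => r = r'
  | .seq p q => p.WritesIntReg r ∨ q.WritesIntReg r
  | .branch _ p q => p.WritesIntReg r ∨ q.WritesIntReg r
  | .loop _ p => p.WritesIntReg r
  | _ => False

/-- The program has an assignment to the real register `r`. -/
def Prog.WritesRealReg (r : ℕ) : Prog → Prop
  | .setReal r' _ => r = r'
  | .seq p q => p.WritesRealReg r ∨ q.WritesRealReg r
  | .branch _ p q => p.WritesRealReg r ∨ q.WritesRealReg r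
  | .loop _ p => p.WritesRealReg r
  | _ => False

/-- The program has a write access to the natural number array `a`. -/
def Prog.WritesIntArr (a : ℕ) : Prog → Prop
  | .writeInt a' _ _ => a = a'
  | .seq p q => p.WritesIntArr a ∨ q.WritesIntArr a
  | .branch _ p q => p.WritesIntArr a ∨ q.WritesIntArr a
  | .loop _ p => p.WritesIntArr a
  | _ => False

/-- The program has a write access to the real array `a`. -/
def Prog.WritesRealArr (a : ℕ) : Prog → Prop
  | .writeReal a' _ _ => a = a'
  | .seq p q => p.WritesRealArr a ∨ q.WritesRealArr a
  | .branch _ p q => p.WritesRealArr a ∨ q.WritesRealArr a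
  | .loop _ p => p.WritesRealArr a
  | _ => False

/-- The memories `s` and `s'` agree on all registers and arrays that `p` does not write to. -/
structure Framed (p : Prog) (s s' : Store) : Prop where
  intReg : ∀ r, ¬ p.WritesIntReg r → s'.intReg r = s.intReg r
  realReg : ∀ r, ¬ p.WritesRealReg r → s'.realReg r = s.realReg r
  intArr : ∀ a, ¬ p.WritesIntArr a → s'.intArr a = s.intArr a
  realArr : ∀ a, ¬ p.WritesRealArr a → s'.realArr a = s.realArr a

theorem Exec.framed {p : Prog} {s s' : Store} {t : ℕ} (h : Exec p s s' t) : Framed p s s' := by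
  induction h with
  | skip s => exact ⟨fun _ _ => rfl, fun _ _ => rfl, fun _ _ => rfl, fun _ _ => rfl⟩
  | setInt s r e =>
    exact ⟨fun r' h => Function.update_of_ne h _ _, fun _ _ => rfl, fun _ _ => rfl, fun _ _ => rfl⟩
  | setReal s r e =>
    exact ⟨fun _ _ => rfl, fun r' h => Function.update_of_ne h _ _, fun _ _ => rfl, fun _ _ => rfl⟩
  | writeInt s a i e =>
    exact ⟨fun _ _ => rfl, fun _ _ => rfl, fun r' h => Function.update_of_ne h _ _, fun _ _ => rfl⟩
  | writeReal s a i e =>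
    exact ⟨fun _ _ => rfl, fun _ _ => rfl, fun _ _ => rfl, fun r' h => Function.update_of_ne h _ _⟩
  | seq _ _ h₁ h₂ =>
    refine ⟨fun r h => ?_, fun r h => ?_, fun r h => ?_, fun r h => ?_⟩
    · exact (h₂.intReg r fun h' => h (.inr h')).trans (h₁.intReg r fun h' => h (.inl h'))
    · exact (h₂.realReg r fun h' => h (.inr h')).trans (h₁.realReg r fun h' => h (.inl h'))
    · exact (h₂.intArr r fun h' => h (.inr h')).trans (h₁.intArr r fun h' => h (.inl h'))
    · exact (h₂.realArr r fun h' => h (.inr h')).trans (h₁.realArr r fun h' => h (.inl h'))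
  | branchTrue _ _ h₁ =>
    exact ⟨fun r h => h₁.intReg r fun h' => h (.inl h'), fun r h => h₁.realReg r fun h' => h (.inl h'),
      fun r h => h₁.intArr r fun h' => h (.inl h'), fun r h => h₁.realArr r fun h' => h (.inl h')⟩
  | branchFalse _ _ h₁ =>
    exact ⟨fun r h => h₁.intReg r fun h' => h (.inr h'), fun r h => h₁.realReg r fun h' => h (.inr h'),
      fun r h => h₁.intArr r fun h' => h (.inr h'), fun r h => h₁.realArr r fun h' => h (.inr h')⟩
  | loopFalse _ => exact ⟨fun _ _ => rfl, fun _ _ => rfl, fun _ _ => rfl, fun _ _ => rfl⟩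
  | loopTrue _ _ _ h₁ h₂ =>
    refine ⟨fun r h => ?_, fun r h => ?_, fun r h => ?_, fun r h => ?_⟩
    · exact (h₂.intReg r h).trans (h₁.intReg r h)
    · exact (h₂.realReg r h).trans (h₁.realReg r h)
    · exact (h₂.intArr r h).trans (h₁.intArr r h)
    · exact (h₂.realArr r h).trans (h₁.realArr r h)

theorem Runs.framed {p : Prog} {s : Store} {t : ℕ} {Q : Store → Prop} (h : Runs p s t Q) :
    Runs p s t fun s' => Q s' ∧ Framed p s s' := by
  obtain ⟨s', u, he, hu, hq⟩ := h
  exact ⟨s', u, he, hu, hq, he.framed⟩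

/-! ### Merge sort on the random access machine

All programs below share the following layout. Natural number registers: `0` holds `n`, `1` the grid
size `m`, `2` the block length of merge sort, `3` the main loop counter, `4` to `11` are local to each
program. Natural number arrays: `0` is the sorted list of indices and `1` its copy under construction,
`2` and `3` hold the cell index and the row offset of every rank, `4` and `5` the ranks of the two
samples, `6` the counts per cell. Truncated subtraction gives minima: `u - (u - v) = min u v`.
-/

/-- `P` permutes the indices below `n`. -/
structure IsIndexPerm (n : ℕ) (P : ℕ → ℕ) : Prop where
  lt : ∀ i < n, P i < n
  inj : ∀ i < n, ∀ j < n, P i = P j → i = j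

/-- The sequence `key ∘ P`, cut at `n`, is increasing on each block `[q w, q w + w)`. -/
def BlockSorted (key : ℕ → ℝ) (n w : ℕ) (P : ℕ → ℕ) : Prop :=
  ∀ q i j, q * w ≤ i → i ≤ j → j < q * w + w → j < n → key (P i) ≤ key (P j)

/-- The state of a merging pass that combines blocks of length `w` of `P` into blocks of length
`2 w` of `Q`. The first `k` entries of `Q` are written; the current output block starts at `lo`,
and its sources `[i, mid)` and `[j, hi)` are what is left of two neighbouring blocks of `P`. -/
structure MergeState (key : ℕ → ℝ) (n w : ℕ) (P Q : ℕ → ℕ) (lo k i mid j hi : ℕ) : Prop where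
  count : k + mid = i + j
  lo_le : lo ≤ i
  i_le : i ≤ mid
  mid_le : mid ≤ j
  j_le : j ≤ hi
  hi_le : hi ≤ n
  hi_le' : hi ≤ lo + (w + w)
  lo_mul : ∃ q, lo = q * (w + w)
  hi_mul : hi = n ∨ ∃ q, hi = q * (w + w)
  source : ∀ a < k, ∃ c < n, Q a = P c ∧ (c < i ∨ (mid ≤ c ∧ c < j))
  inj : ∀ a < k, ∀ b < k, Q a = Q b → a = b
  sorted : ∀ q a b, q * (w + w) ≤ a → a ≤ b → b < q * (w + w) + (w + w) → b < k →
    key (Q a) ≤ key (Q b)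
  bound : ∀ a, lo ≤ a → a < k → ∀ c, (i ≤ c ∧ c < mid ∨ j ≤ c ∧ c < hi) → key (Q a) ≤ key (P c)
  left : ∀ c d, i ≤ c → c ≤ d → d < mid → key (P c) ≤ key (P d)
  right : ∀ c d, j ≤ c → c ≤ d → d < hi → key (P c) ≤ key (P d)

namespace MergeState

variable {key : ℕ → ℝ} {n w : ℕ} {P Q : ℕ → ℕ} {lo k i mid j hi : ℕ}

theorem start (key : ℕ → ℝ) (n w : ℕ) (P Q : ℕ → ℕ) : MergeState key n w P Q 0 0 0 0 0 0 where
  count := rfl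
  lo_le := le_rfl
  i_le := le_rfl
  mid_le := le_rfl
  j_le := le_rfl
  hi_le := Nat.zero_le _
  hi_le' := Nat.zero_le _
  lo_mul := ⟨0, by simp⟩
  hi_mul := .inr ⟨0, by simp⟩
  source := fun a h => absurd h (by omega)
  inj := fun a h => absurd h (by omega)
  sorted := fun _ _ _ _ _ _ h => absurd h (by omega)
  bound := fun a _ h => absurd h (by omega)
  left := fun _ _ _ _ h => absurd h (by omega)
  right := fun _ _ _ _ h => absurd h (by omega)

/-- At the end of an output block the next pair of source blocks is opened; the last block or the
last pair may be cut off by `n`. -/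
theorem nextBlock (h : MergeState key n w P Q lo k i mid j hi) (hP : BlockSorted key n w P)
    (hk : k < n) (hik : hi ≤ k) :
    MergeState key n w P Q k k k (min (k + w) n) (min (k + w) n) (min (min (k + w) n + w) n) := by
  have h1 := h.count; have h2 := h.i_le; have h3 := h.mid_le; have h4 := h.j_le
  obtain ⟨q, hq⟩ : ∃ q, k = q * (w + w) := by
    rcases h.hi_mul with h' | ⟨q, hq⟩
    · omega
    · exact ⟨q, by omega⟩
  have e1 : 2 * q * w = k := by rw [hq]; ring
  have e2 : (2 * q + 1) * w = k + w := by rw [hq]; ring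
  refine ⟨by omega, le_rfl, by omega, le_rfl, by omega, by omega, by omega, ⟨q, hq⟩, ?_, ?_, h.inj,
    h.sorted, fun a h1 h2 => absurd h2 (by omega), ?_, ?_⟩
  · by_cases hn : n ≤ k + w + w
    · left; omega
    · refine .inr ⟨q + 1, ?_⟩
      rw [add_one_mul, ← hq]; omega
  · intro a ha
    obtain ⟨c, hc, e, h'⟩ := h.source a ha
    exact ⟨c, hc, e, .inl (by omega)⟩
  · intro c d h1 h2 h3
    exact hP (2 * q) c d (by omega) h2 (by omega) (by omega)
  · intro c d h1 h2 h3
    by_cases hn : n ≤ k + w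
    · omega
    · exact hP (2 * q + 1) c d (by omega) h2 (by omega) (by omega)

/-- Writing any source entry `c` that is left to position `k` keeps `Q` injective and its blocks
sorted. -/
theorem step_aux (h : MergeState key n w P Q lo k i mid j hi) (hP : IsIndexPerm n P)
    {c : ℕ} (hc : i ≤ c ∧ c < mid ∨ j ≤ c ∧ c < hi) :
    (∀ a < k + 1, ∀ b < k + 1, Function.update Q k (P c) a = Function.update Q k (P c) b → a = b) ∧
    (∀ q a b, q * (w + w) ≤ a → a ≤ b → b < q * (w + w) + (w + w) → b < k + 1 →
      key (Function.update Q k (P c) a) ≤ key (Function.update Q k (P c) b)) := by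
  have h1 := h.count; have h2 := h.i_le; have h3 := h.mid_le; have h4 := h.j_le
  have h5 := h.hi_le; have h6 := h.lo_le; have h7 := h.hi_le'
  have ne : ∀ a < k, Q a ≠ P c := by
    intro a ha e
    obtain ⟨d, hd, e', h'⟩ := h.source a ha
    have := hP.inj d hd c (by omega) (e'.symm.trans e)
    omega
  refine ⟨fun a ha b hb e => ?_, fun q a b h8 h9 h10 h11 => ?_⟩
  · rcases eq_or_ne a k with rfl | hak <;> rcases eq_or_ne b a with rfl | hbk
    · rfl
    · rw [Function.update_self, Function.update_of_ne hbk] at e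
      exact absurd e.symm (ne b (by omega))
    · rfl
    · rcases eq_or_ne b k with rfl | hbk'
      · rw [Function.update_self, Function.update_of_ne hak] at e
        exact absurd e (ne a (by omega))
      · rw [Function.update_of_ne hbk', Function.update_of_ne hak] at e
        exact h.inj a (by omega) b (by omega) e
  · rcases eq_or_ne b k with rfl | hbk
    · rcases eq_or_ne a b with rfl | hak
      · exact le_rfl
      · rw [Function.update_self, Function.update_of_ne hak]
        refine h.bound a ?_ (by omega) c hc
        obtain ⟨q₀, hq₀⟩ := h.lo_mul
        have hq : q₀ ≤ q := by
          by_contra hlt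
          have : (q + 1) * (w + w) ≤ q₀ * (w + w) := Nat.mul_le_mul_right _ (by omega)
          rw [add_one_mul] at this
          omega
        have := Nat.mul_le_mul_right (w + w) hq
        omega
    · rw [Function.update_of_ne hbk, Function.update_of_ne (by omega)]
      exact h.sorted q a b h8 h9 h10 (by omega)

/-- The left source is also taken when the right one is exhausted, hence the premise `j < hi`. -/
theorem takeLeft (h : MergeState key n w P Q lo k i mid j hi) (hP : IsIndexPerm n P)
    (hi' : i < mid) (hle : j < hi → key (P i) ≤ key (P j)) :
    MergeState key n w P (Function.update Q k (P i)) lo (k + 1) (i + 1) mid j hi := by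
  have h1 := h.count; have h2 := h.i_le; have h3 := h.mid_le; have h4 := h.j_le
  have h5 := h.hi_le; have h6 := h.lo_le; have h7 := h.hi_le'
  obtain ⟨hinj, hsort⟩ := h.step_aux hP (.inl ⟨le_rfl, hi'⟩)
  refine ⟨by omega, by omega, by omega, h3, h4, h5, h7, h.lo_mul, h.hi_mul, ?_, hinj, hsort, ?_,
    fun c d h8 => h.left c d (by omega), h.right⟩
  · intro a ha
    rcases eq_or_ne a k with rfl | hak
    · exact ⟨i, by omega, by rw [Function.update_self], .inl (by omega)⟩
    · obtain ⟨c, hc, e, h'⟩ := h.source a (by omega)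
      exact ⟨c, hc, by rw [Function.update_of_ne hak, e], by omega⟩
  · intro a ha hak c hc
    rcases eq_or_ne a k with rfl | hak'
    · rw [Function.update_self]
      rcases hc with hc | hc
      · exact h.left i c le_rfl (by omega) hc.2
      · exact (hle (by omega)).trans (h.right j c le_rfl hc.1 hc.2)
    · rw [Function.update_of_ne hak']
      exact h.bound a ha (by omega) c (by omega)

theorem takeRight (h : MergeState key n w P Q lo k i mid j hi) (hP : IsIndexPerm n P)
    (hj : j < hi) (hle : i < mid → key (P j) ≤ key (P i)) :
    MergeState key n w P (Function.update Q k (P j)) lo (k + 1) i mid (j + 1) hi := by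
  have h1 := h.count; have h2 := h.i_le; have h3 := h.mid_le; have h4 := h.j_le
  have h5 := h.hi_le; have h6 := h.lo_le; have h7 := h.hi_le'
  obtain ⟨hinj, hsort⟩ := h.step_aux hP (.inr ⟨le_rfl, hj⟩)
  refine ⟨by omega, by omega, by omega, by omega, hj, h5, h7, h.lo_mul, h.hi_mul, ?_, hinj, hsort,
    ?_, h.left, fun c d h8 => h.right c d (by omega)⟩
  · intro a ha
    rcases eq_or_ne a k with rfl | hak
    · exact ⟨j, by omega, by rw [Function.update_self], .inr (by omega)⟩
    · obtain ⟨c, hc, e, h'⟩ := h.source a (by omega)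
      exact ⟨c, hc, by rw [Function.update_of_ne hak, e], by omega⟩
  · intro a ha hak c hc
    rcases eq_or_ne a k with rfl | hak'
    · rw [Function.update_self]
      rcases hc with hc | hc
      · exact (hle (by omega)).trans (h.left i c le_rfl (by omega) hc.2)
      · exact h.right j c le_rfl (by omega) hc.2
    · rw [Function.update_of_ne hak']
      exact h.bound a ha (by omega) c (by omega)

theorem isIndexPerm (h : MergeState key n w P Q lo n i mid j hi) (hP : IsIndexPerm n P) :
    IsIndexPerm n Q := by
  refine ⟨fun a ha => ?_, h.inj⟩
  obtain ⟨c, hc, e, -⟩ := h.source a ha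
  exact e ▸ hP.lt c hc

theorem blockSorted (h : MergeState key n w P Q lo n i mid j hi) :
    BlockSorted key n (w + w) Q := h.sorted

end MergeState

/-- The indices of the source array, in the order `0, 1, …`. -/
def fillProg : Prog :=
  .seq (.setInt 3 (.lit 0))
    (.loop (.neg (.intLe (.reg 0) (.reg 3)))
      (.seq (.writeInt 0 (.reg 3) (.reg 3)) (.setInt 3 (.plus (.reg 3) (.lit 1)))))

theorem runs_fillProg (s : Store) :
    Runs fillProg s (12 * s.intReg 0 + 8) fun s' => ∀ i < s.intReg 0, s'.intArr 0 i = i := by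
  refine Runs.mono (Runs.seq (R := fun s' => s'.intReg 3 = 0 ∧ s'.intReg 0 = s.intReg 0)
    (Runs.of_wp ?_) fun s₁ h₁ => Runs.loop (fun k s' => s'.intReg 3 = k ∧
      s'.intReg 0 = s.intReg 0 ∧ ∀ i < k, s'.intArr 0 i = i) (s.intReg 0) _
      (fun k hk s' h => ⟨?_, Runs.of_wp ?_⟩) (fun s' h => ?_) ?_) ?_ fun s' h => h.2.2
  · simp [Prog.wp, Store.setIntReg, IntExpr.val]
  · simp only [BoolExpr.Holds, IntExpr.val]; omega
  · simp only [Prog.wp, Store.setIntReg, Store.setIntCell, IntExpr.val]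
    obtain ⟨h1, h2, h3⟩ := h
    refine ⟨by simp [h1], by simpa using h2, fun i hi => ?_⟩
    rcases eq_or_ne i k with rfl | hik
    · simp [h1]
    · simp [h1, hik]; exact h3 i (by omega)
  · simp only [BoolExpr.Holds, IntExpr.val]; omega
  · simpa using h₁
  · simp only [Prog.maxCost, IntExpr.cost, BoolExpr.cost]
    omega

/-- One pass of merge sort from array `0` to array `1`, with blocks of the length held in
register `2`, comparing the entries of the real array `a`. -/
def mergeProg (a : ℕ) : Prog :=
  .seq (.seq (.setInt 3 (.lit 0)) (.seq (.setInt 4 (.lit 0)) (.seq (.setInt 5 (.lit 0))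
    (.seq (.setInt 6 (.lit 0)) (.setInt 7 (.lit 0))))))
  (.loop (.neg (.intLe (.reg 0) (.reg 3)))
    (.seq
      (.branch (.intLe (.reg 7) (.reg 3))
        (.seq (.setInt 4 (.reg 3))
        (.seq (.setInt 5 (.minus (.plus (.reg 3) (.reg 2))
          (.minus (.plus (.reg 3) (.reg 2)) (.reg 0))))
        (.seq (.setInt 6 (.reg 5))
        (.setInt 7 (.minus (.plus (.reg 5) (.reg 2))
          (.minus (.plus (.reg 5) (.reg 2)) (.reg 0)))))))
        .skip)
    (.seq
      (.branch (.both (.neg (.intLe (.reg 5) (.reg 4)))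
          (.neg (.both (.neg (.intLe (.reg 7) (.reg 6)))
            (.neg (.realLe (.read a (.read 0 (.reg 4))) (.read a (.read 0 (.reg 6))))))))
        (.seq (.writeInt 1 (.reg 3) (.read 0 (.reg 4))) (.setInt 4 (.plus (.reg 4) (.lit 1))))
        (.seq (.writeInt 1 (.reg 3) (.read 0 (.reg 6))) (.setInt 6 (.plus (.reg 6) (.lit 1)))))
      (.setInt 3 (.plus (.reg 3) (.lit 1))))))

theorem runs_mergeProg (a : ℕ) (s : Store) (hw : 0 < s.intReg 2)
    (hP : IsIndexPerm (s.intReg 0) (s.intArr 0))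
    (hB : BlockSorted (s.realArr a) (s.intReg 0) (s.intReg 2) (s.intArr 0)) :
    Runs (mergeProg a) s (100 * s.intReg 0 + 20) fun s' =>
      IsIndexPerm (s.intReg 0) (s'.intArr 1) ∧
      BlockSorted (s.realArr a) (s.intReg 0) (s.intReg 2 + s.intReg 2) (s'.intArr 1) := by
  set n := s.intReg 0 with hn
  set w := s.intReg 2 with hw'
  set P := s.intArr 0 with hP'
  set key := s.realArr a with hkey
  let I : ℕ → Store → Prop := fun k s' => (s'.intReg 0 = n ∧ s'.intReg 2 = w ∧ s'.intArr 0 = P ∧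
    s'.realArr a = key) ∧ s'.intReg 3 = k ∧ ∃ lo, MergeState key n w P (s'.intArr 1) lo k
      (s'.intReg 4) (s'.intReg 5) (s'.intReg 6) (s'.intReg 7)
  refine Runs.mono (Runs.seq (R := I 0)
    (Runs.of_wp ?_) fun s₁ h₁ => Runs.loop I n _
      (fun k hk s' h => ⟨?_, (Runs.of_wp ?_)⟩) (fun s' h => ?_) h₁) ?_
      fun s' ⟨_, _, lo, h⟩ => ⟨h.isIndexPerm hP, h.blockSorted⟩
  · refine ⟨?_, ?_, 0, ?_⟩
    · simp [Store.setIntReg, hn, hw', hP', hkey]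
    · simp [Store.setIntReg, IntExpr.val]
    · simpa [Store.setIntReg, IntExpr.val] using MergeState.start key n w P _
  · simp only [BoolExpr.Holds, IntExpr.val, h.1.1, h.2.1]; omega
  · obtain ⟨⟨e0, e2, eP, eK⟩, e3, lo, hM⟩ := h
    -- The merging step proper, once the source blocks of position `k` are open.
    have main : ∀ s' : Store, ((s'.intReg 0 = n ∧ s'.intReg 2 = w ∧ s'.intArr 0 = P ∧
        s'.realArr a = key) ∧ s'.intReg 3 = k ∧ ∃ lo, MergeState key n w P (s'.intArr 1) lo k
        (s'.intReg 4) (s'.intReg 5) (s'.intReg 6) (s'.intReg 7)) → k < s'.intReg 7 →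
        (Prog.seq (.branch (.both (.neg (.intLe (.reg 5) (.reg 4)))
          (.neg (.both (.neg (.intLe (.reg 7) (.reg 6)))
            (.neg (.realLe (.read a (.read 0 (.reg 4))) (.read a (.read 0 (.reg 6))))))))
          (.seq (.writeInt 1 (.reg 3) (.read 0 (.reg 4))) (.setInt 4 (.plus (.reg 4) (.lit 1))))
          (.seq (.writeInt 1 (.reg 3) (.read 0 (.reg 6))) (.setInt 6 (.plus (.reg 6) (.lit 1)))))
        (.setInt 3 (.plus (.reg 3) (.lit 1)))).wp (I (k + 1)) s' := by
      rintro s' ⟨⟨e0, e2, eP, eK⟩, e3, lo, hM⟩ hlt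
      have h1 := hM.count; have h2 := hM.i_le; have h3 := hM.mid_le; have h4 := hM.j_le
      refine ⟨fun hb => ?_, fun hb => ?_⟩
      · simp only [BoolExpr.Holds, IntExpr.val, RealExpr.val, eP, eK, not_le, not_and, not_lt] at hb
        refine ⟨by simp [IntExpr.val, Store.setIntReg, Store.setIntCell, e0, e2, eP, eK],
          by simp [IntExpr.val, Store.setIntReg, Store.setIntCell, e3], lo, ?_⟩
        simpa [IntExpr.val, Store.setIntReg, Store.setIntCell, e3, eP] using
          hM.takeLeft hP hb.1 hb.2
      · simp only [BoolExpr.Holds, IntExpr.val, RealExpr.val, eP, eK, not_le, not_and, not_lt] at hb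
        refine ⟨by simp [IntExpr.val, Store.setIntReg, Store.setIntCell, e0, e2, eP, eK],
          by simp [IntExpr.val, Store.setIntReg, Store.setIntCell, e3], lo, ?_⟩
        have := hM.takeRight hP (by by_contra h'; have := hb (by omega) (by omega); omega)
          (fun h' => by have := hb h'; push Not at this; exact this.2.le)
        simpa [IntExpr.val, Store.setIntReg, Store.setIntCell, e3, eP] using this
    refine ⟨fun hb => main _ ?_ ?_, fun hb => main _ ⟨⟨e0, e2, eP, eK⟩, e3, lo, hM⟩ ?_⟩
    · simp only [BoolExpr.Holds, IntExpr.val] at hb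
      refine ⟨by simp [Store.setIntReg, e0, e2, eP, eK], by simp [Store.setIntReg, e3], k, ?_⟩
      have := hM.nextBlock hB hk (by omega)
      have t : ∀ u v : ℕ, u - (u - v) = min u v := fun u v => by omega
      simpa [IntExpr.val, Store.setIntReg, e3, e0, e2, t] using this
    · simp [IntExpr.val, Store.setIntReg, e3, e0, e2]; omega
    · simp only [BoolExpr.Holds, IntExpr.val] at hb; omega
  · simp only [BoolExpr.Holds, IntExpr.val, h.1.1, h.2.1]; omega
  · simp only [Prog.maxCost, IntExpr.cost, BoolExpr.cost, RealExpr.cost]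
    omega

/-- Copies the first entries of array `1` to array `0`. -/
def copyProg : Prog :=
  .seq (.setInt 3 (.lit 0))
    (.loop (.neg (.intLe (.reg 0) (.reg 3)))
      (.seq (.writeInt 0 (.reg 3) (.read 1 (.reg 3))) (.setInt 3 (.plus (.reg 3) (.lit 1)))))

theorem runs_copyProg (s : Store) :
    Runs copyProg s (13 * s.intReg 0 + 8) fun s' =>
      ∀ i < s.intReg 0, s'.intArr 0 i = s.intArr 1 i := by
  refine Runs.mono (Runs.seq (R := fun s' => s'.intReg 3 = 0 ∧ s'.intReg 0 = s.intReg 0 ∧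
    s'.intArr 1 = s.intArr 1)
    (Runs.of_wp ?_) fun s₁ h₁ => Runs.loop (fun k s' => s'.intReg 3 = k ∧
      s'.intReg 0 = s.intReg 0 ∧ s'.intArr 1 = s.intArr 1 ∧ ∀ i < k, s'.intArr 0 i = s.intArr 1 i)
      (s.intReg 0) _ (fun k hk s' h => ⟨?_, Runs.of_wp ?_⟩) (fun s' h => ?_) ?_) ?_
      fun s' h => h.2.2.2
  · simp [Prog.wp, Store.setIntReg, IntExpr.val]
  · simp only [BoolExpr.Holds, IntExpr.val]; omega
  · simp only [Prog.wp, Store.setIntReg, Store.setIntCell, IntExpr.val]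
    obtain ⟨h1, h2, h3, h4⟩ := h
    refine ⟨by simp [h1], by simpa using h2, by simpa using h3, fun i hi => ?_⟩
    rcases eq_or_ne i k with rfl | hik
    · simp [h1, h3]
    · simp [h1, hik]; exact h4 i (by omega)
  · simp only [BoolExpr.Holds, IntExpr.val]; omega
  · simpa using h₁
  · simp only [Prog.maxCost, IntExpr.cost, BoolExpr.cost]
    omega

theorem IsIndexPerm.congr {n : ℕ} {P Q : ℕ → ℕ} (h : IsIndexPerm n P) (e : ∀ i < n, Q i = P i) :
    IsIndexPerm n Q :=
  ⟨fun i hi => by rw [e i hi]; exact h.lt i hi,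
    fun i hi j hj he => h.inj i hi j hj (by rwa [e i hi, e j hj] at he)⟩

theorem BlockSorted.congr {key : ℕ → ℝ} {n w : ℕ} {P Q : ℕ → ℕ} (h : BlockSorted key n w P)
    (e : ∀ i < n, Q i = P i) : BlockSorted key n w Q := fun q i j h1 h2 h3 h4 => by
  rw [e i (by omega), e j h4]
  exact h q i j h1 h2 h3 h4

/-- Sorts the indices below `n`, held in array `0`, by the entries of the real array `a`. -/
def sortProg (a : ℕ) : Prog :=
  .seq fillProg (.seq (.setInt 2 (.lit 1))
    (.loop (.neg (.intLe (.reg 0) (.reg 2)))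
      (.seq (mergeProg a) (.seq copyProg (.setInt 2 (.plus (.reg 2) (.reg 2)))))))

theorem runs_sortProg (a : ℕ) (s : Store) :
    Runs (sortProg a) s (Nat.clog 2 (s.intReg 0) * (113 * s.intReg 0 + 40) + 12 * s.intReg 0 + 20)
      fun s' => IsIndexPerm (s.intReg 0) (s'.intArr 0) ∧
        ∀ i j, i ≤ j → j < s.intReg 0 →
          s.realArr a (s'.intArr 0 i) ≤ s.realArr a (s'.intArr 0 j) := by
  set n := s.intReg 0 with hn
  set key := s.realArr a with hkey
  let J : Store → Prop := fun s' => s'.intReg 0 = n ∧ s'.realArr a = key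
  let I : ℕ → Store → Prop := fun k s' => J s' ∧ s'.intReg 2 = 2 ^ k ∧
    IsIndexPerm n (s'.intArr 0) ∧ BlockSorted key n (2 ^ k) (s'.intArr 0)
  have hlog : n ≤ 2 ^ Nat.clog 2 n := Nat.le_pow_clog one_lt_two n
  refine Runs.mono (Runs.seq (runs_fillProg s).framed fun s₁ ⟨h₁, f₁⟩ => Runs.seq (R := I 0)
    (Runs.of_wp ?_) fun s₂ h₂ => Runs.loop I (Nat.clog 2 n) (113 * n + 32)
      (fun k hk s' h => ⟨?_, ?_⟩) (fun s' h => ?_) h₂) ?_ ?_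
  · have hid : ∀ i < n, s₁.intArr 0 i = id i := h₁
    have hp : IsIndexPerm n id := ⟨fun i hi => hi, fun i _ j _ h => h⟩
    have hb : BlockSorted key n 1 id := fun q i j h1 h2 h3 h4 => by
      have : i = j := by omega
      rw [this]
    have f0 := f₁.intReg 0 (by simp [fillProg, Prog.WritesIntReg])
    have fa := f₁.realArr a (by simp [fillProg, Prog.WritesRealArr])
    refine ⟨⟨?_, ?_⟩, ?_, ?_, ?_⟩
    · simpa [Store.setIntReg] using f0
    · simpa [Store.setIntReg] using fa
    · simp [Store.setIntReg, IntExpr.val]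
    · simpa [Store.setIntReg] using hp.congr hid
    · simpa [Store.setIntReg] using hb.congr hid
  · obtain ⟨⟨e0, _⟩, e2, _⟩ := h
    simp only [BoolExpr.Holds, IntExpr.val, e0, e2, not_le]
    exact (Nat.lt_clog_iff_pow_lt one_lt_two).1 hk
  · obtain ⟨⟨e0, ek⟩, e2, hp, hb⟩ := h
    have hm := (runs_mergeProg a s' (by rw [e2]; positivity) (by rwa [e0])
      (by rwa [e0, e2, ek])).framed
    rw [e0, e2, ek] at hm
    refine Runs.mono (Runs.seq hm (t₂ := 13 * n + 8 + 4) fun s₃ ⟨⟨hp₃, hb₃⟩, f₃⟩ => ?_)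
      (by omega) fun _ h => h
    have i0 := (f₃.intReg 0 (by simp [mergeProg, Prog.WritesIntReg])).trans e0
    have i2 := (f₃.intReg 2 (by simp [mergeProg, Prog.WritesIntReg])).trans e2
    have ra := (f₃.realArr a (by simp [mergeProg, Prog.WritesRealArr])).trans ek
    have hc := (runs_copyProg s₃).framed
    rw [i0] at hc
    refine Runs.seq hc fun s₄ ⟨h₄, f₄⟩ => Runs.of_wp (Q := I (k + 1)) ?_
    have j0 := (f₄.intReg 0 (by simp [copyProg, Prog.WritesIntReg])).trans i0
    have j2 := (f₄.intReg 2 (by simp [copyProg, Prog.WritesIntReg])).trans i2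
    have rb := (f₄.realArr a (by simp [copyProg, Prog.WritesRealArr])).trans ra
    have e : 2 ^ (k + 1) = 2 ^ k + 2 ^ k := by ring
    refine ⟨⟨?_, ?_⟩, ?_, ?_, ?_⟩
    · simpa [Store.setIntReg] using j0
    · simpa [Store.setIntReg] using rb
    · simp [Store.setIntReg, IntExpr.val, j2, e]
    · simpa [Store.setIntReg] using hp₃.congr h₄
    · simpa [Store.setIntReg, e] using hb₃.congr h₄
  · obtain ⟨⟨e0, _⟩, e2, _⟩ := h
    simp only [BoolExpr.Holds, IntExpr.val, e0, e2, not_le, not_lt]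
    exact hlog
  · simp only [Prog.maxCost, IntExpr.cost, BoolExpr.cost]
    ring_nf
    omega
  · rintro s' ⟨-, -, hp, hb⟩
    exact ⟨hp, fun i j hij hj => hb 0 i j (by omega) hij (by omega) hj⟩

/-! ### Ranks -/

/-- The number of `j < n` with `key j ≤ v`. -/
noncomputable def rankBelow (key : ℕ → ℝ) (n : ℕ) (v : ℝ) : ℕ :=
  ((Finset.range n).filter fun j => key j ≤ v).card

theorem IsIndexPerm.image_range {n : ℕ} {P : ℕ → ℕ} (h : IsIndexPerm n P) :
    (Finset.range n).image P = Finset.range n := by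
  refine Finset.eq_of_subset_of_card_le (fun i hi => ?_) ?_
  · obtain ⟨j, hj, rfl⟩ := Finset.mem_image.1 hi
    exact Finset.mem_range.2 (h.lt j (Finset.mem_range.1 hj))
  · rw [Finset.card_image_of_injOn]
    intro i hi j hj e
    exact h.inj i (by simpa using hi) j (by simpa using hj) e

/-- If `key ∘ P` crosses the value `v` at position `t`, then `v` has rank `t`. -/
theorem rankBelow_eq {key : ℕ → ℝ} {n t : ℕ} {v : ℝ} {P : ℕ → ℕ} (h : IsIndexPerm n P)
    (ht : t ≤ n) (hle : ∀ i < t, key (P i) ≤ v) (hlt : ∀ i, t ≤ i → i < n → v < key (P i)) :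
    rankBelow key n v = t := by
  have : (Finset.range n).filter (fun j => key j ≤ v) = (Finset.range t).image P := by
    ext j
    simp only [Finset.mem_filter, Finset.mem_image]
    constructor
    · rintro ⟨hj, hv⟩
      rw [← h.image_range] at hj
      obtain ⟨i, hi, rfl⟩ := Finset.mem_image.1 hj
      refine ⟨i, Finset.mem_range.2 ?_, rfl⟩
      by_contra hti
      exact absurd hv (not_le.2 (hlt i (by simpa using hti) (by simpa using hi)))
    · rintro ⟨i, hi, rfl⟩
      rw [Finset.mem_range] at hi
      exact ⟨Finset.mem_range.2 (h.lt i (by omega)), hle i hi⟩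
  rw [rankBelow, this, Finset.card_image_of_injOn, Finset.card_range]
  intro i hi j hj e
  have hi' : i < t := by simpa using hi
  have hj' : j < t := by simpa using hj
  exact h.inj i (by omega) j (by omega) e

theorem sampleRank_eq_rankBelow {n : ℕ} (x : Fin n → ℝ) (key : ℕ → ℝ)
    (h : ∀ i : Fin n, key i = x i) (k : Fin n) : sampleRank x k = rankBelow key n (key k) := by
  simp only [sampleRank, rankBelow, Finset.card_filter, Finset.sum_range, h]

/-- With the indices in array `0` sorted by the real array `a`, scans them downwards and writes
the ranks of the entries of `a` into the array `b`. -/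
def rankProg (a b : ℕ) : Prog :=
  .seq (.seq (.setInt 3 (.reg 0)) (.setInt 11 (.reg 0)))
    (.loop (.intLe (.lit 1) (.reg 3))
      (.seq (.branch (.both (.neg (.intLe (.reg 0) (.reg 3)))
          (.neg (.realLe (.read a (.read 0 (.reg 3)))
            (.read a (.read 0 (.minus (.reg 3) (.lit 1)))))))
          (.setInt 11 (.reg 3)) .skip)
      (.seq (.writeInt b (.read 0 (.minus (.reg 3) (.lit 1))) (.reg 11))
        (.setInt 3 (.minus (.reg 3) (.lit 1))))))

theorem runs_rankProg (a b : ℕ) (hb : b ≠ 0) (s : Store)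
    (hP : IsIndexPerm (s.intReg 0) (s.intArr 0))
    (hS : ∀ i j, i ≤ j → j < s.intReg 0 → s.realArr a (s.intArr 0 i) ≤ s.realArr a (s.intArr 0 j)) :
    Runs (rankProg a b) s (40 * s.intReg 0 + 20) fun s' => ∀ i < s.intReg 0,
      s'.intArr b i = rankBelow (s.realArr a) (s.intReg 0) (s.realArr a i) := by
  set n := s.intReg 0 with hn
  set P := s.intArr 0 with hP'
  set key := s.realArr a with hkey
  -- Register `11` holds the rank of the entry scanned last. Within a group of ties it keeps the
  -- value it got at the last position of the group.
  let I : ℕ → Store → Prop := fun t s' => (s'.intReg 0 = n ∧ s'.intArr 0 = P ∧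
    s'.realArr a = key) ∧ s'.intReg 3 = n - t ∧
    (t = 0 → s'.intReg 11 = n) ∧
    (0 < t → s'.intReg 11 = rankBelow key n (key (P (n - t)))) ∧
    ∀ i, n - t ≤ i → i < n → s'.intArr b (P i) = rankBelow key n (key (P i))
  refine Runs.mono (Runs.seq (R := I 0)
    (Runs.of_wp ?_) fun s₁ h₁ => Runs.loop I n _
      (fun k hk s' h => ⟨?_, (Runs.of_wp ?_)⟩) (fun s' h => ?_) h₁) ?_
      fun s' ⟨_, _, _, _, h⟩ i hi => ?_
  · refine ⟨⟨?_, ?_, ?_⟩, ?_, fun _ => ?_, fun h => absurd h (lt_irrefl _), fun i h1 h2 => ?_⟩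
    · simp [Store.setIntReg, hn]
    · simp [Store.setIntReg, hP']
    · simp [Store.setIntReg, hkey]
    · simp [Store.setIntReg, IntExpr.val, hn]
    · simp [Store.setIntReg, IntExpr.val, hn]
    · omega
  · simp only [BoolExpr.Holds, IntExpr.val, h.2.1]; omega
  · obtain ⟨⟨e0, eP, eK⟩, e3, e11, e11', hR⟩ := h
    -- The continuation after register `11` has received the rank of the entry at `n - k - 1`.
    have main : ∀ s' : Store, (s'.intReg 0 = n ∧ s'.intArr 0 = P ∧ s'.realArr a = key) →
        s'.intReg 3 = n - k → s'.intReg 11 = rankBelow key n (key (P (n - (k + 1)))) →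
        (∀ i, n - k ≤ i → i < n → s'.intArr b (P i) = rankBelow key n (key (P i))) →
        (Prog.seq (.writeInt b (.read 0 (.minus (.reg 3) (.lit 1))) (.reg 11))
          (.setInt 3 (.minus (.reg 3) (.lit 1)))).wp (I (k + 1)) s' := by
      rintro s' ⟨e0, eP, eK⟩ e3 e11 hR
      refine ⟨⟨?_, ?_, ?_⟩, ?_, fun h => absurd h (by omega), fun h => ?_, fun i h1 h2 => ?_⟩
      · simp [Store.setIntReg, Store.setIntCell, e0]
      · simp [Store.setIntReg, Store.setIntCell, eP, hb.symm]
      · simp [Store.setIntReg, Store.setIntCell, eK]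
      · simp [Store.setIntReg, Store.setIntCell, IntExpr.val, e3]; omega
      · simp [Store.setIntReg, Store.setIntCell, e11]
      · have e : n - k - 1 = n - (k + 1) := by omega
        simp only [Store.setIntReg, Store.setIntCell, IntExpr.val, e3, eP, e11,
          Function.update_self, e]
        by_cases hi : i = n - (k + 1)
        · rw [hi, Function.update_self]
        · rw [Function.update_of_ne, hR i (by omega) h2]
          exact fun h => hi (hP.inj i h2 _ (by omega) h)
    have e : n - k - 1 = n - (k + 1) := by omega
    refine ⟨fun hb => main _ ?_ ?_ ?_ ?_, fun hb => main _ ⟨e0, eP, eK⟩ e3 ?_ hR⟩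
    · simp [Store.setIntReg, e0, eP, eK]
    · simp [Store.setIntReg, e3]
    · simp only [BoolExpr.Holds, IntExpr.val, RealExpr.val, e0, e3, eP, eK, not_le, e] at hb
      simp only [Store.setIntReg, IntExpr.val, Function.update_self, e3]
      symm
      refine rankBelow_eq hP (by omega) (fun i hi => hS _ _ (by omega) (by omega)) fun i hi hi' => ?_
      exact hb.2.trans_le (hS _ _ hi hi')
    · simpa [Store.setIntReg] using hR
    · simp only [BoolExpr.Holds, IntExpr.val, RealExpr.val, e0, e3, eP, eK, not_le, e,
        not_and, not_lt] at hb
      rcases Nat.eq_zero_or_pos k with rfl | hk0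
      · rw [e11 rfl]
        symm
        exact rankBelow_eq hP le_rfl (fun i hi => hS _ _ (by omega) (by omega))
          fun i h1 h2 => absurd h1 (by omega)
      · rw [e11' hk0, le_antisymm (hb (by omega)) (hS _ _ (by omega) (by omega))]
  · simp only [BoolExpr.Holds, IntExpr.val, h.2.1]; omega
  · simp only [Prog.maxCost, IntExpr.cost, BoolExpr.cost, RealExpr.cost]
    omega
  · have hi' : i ∈ (Finset.range n).image P := by
      rw [hP.image_range]; exact Finset.mem_range.2 hi
    obtain ⟨j, hj, rfl⟩ := Finset.mem_image.1 hi'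
    exact h j (by omega) (by simpa using hj)

/-! ### The grid size and the cell of each rank -/

/-- Computes `⌊n ^ κ⌋` by counting up. -/
def gridSizeProg : Prog :=
  .seq (.seq (.setReal 1 (.power (.ofInt (.reg 0)) (.reg 0))) (.setInt 1 (.lit 0)))
    (.loop (.realLe (.ofInt (.plus (.reg 1) (.lit 1))) (.reg 1))
      (.setInt 1 (.plus (.reg 1) (.lit 1))))

theorem runs_gridSizeProg (s : Store) :
    Runs gridSizeProg s (15 * ⌊(s.intReg 0 : ℝ) ^ s.realReg 0⌋₊ + 20) fun s' =>
      s'.intReg 1 = ⌊(s.intReg 0 : ℝ) ^ s.realReg 0⌋₊ := by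
  set v := (s.intReg 0 : ℝ) ^ s.realReg 0 with hv
  let I : ℕ → Store → Prop := fun k s' => s'.realReg 1 = v ∧ s'.intReg 1 = k
  refine Runs.mono (Runs.seq (R := I 0)
    (Runs.of_wp ?_) fun s₁ h₁ => Runs.loop I ⌊v⌋₊ _
      (fun k hk s' h => ⟨?_, (Runs.of_wp ?_)⟩) (fun s' h => ?_) h₁) ?_ fun s' h => h.2
  · simp [Prog.wp, I, Store.setIntReg, Store.setRealReg, IntExpr.val, RealExpr.val, hv]
  · simp only [BoolExpr.Holds, IntExpr.val, RealExpr.val, h.1, h.2]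
    exact (Nat.le_floor_iff (by positivity)).1 hk
  · simp [Prog.wp, I, Store.setIntReg, IntExpr.val, h.1, h.2]
  · simp only [BoolExpr.Holds, IntExpr.val, RealExpr.val, h.1, h.2]
    push_cast
    exact not_le.2 (Nat.lt_floor_add_one v)
  · simp only [Prog.maxCost, IntExpr.cost, BoolExpr.cost, RealExpr.cost]
    omega

/-- Tabulates, for every rank `r ≤ n`, the cell index `c = ⌊r m / (n + 1)⌋` (array `2`) and the
offset `c m` of row `c` (array `3`). As `m ≤ n`, the index grows by at most one per step, and the
remainder in register `8` tells when. -/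
def cellProg : Prog :=
  .seq (.seq (.setInt 3 (.lit 0)) (.seq (.setInt 8 (.lit 0)) (.seq (.setInt 9 (.lit 0))
    (.setInt 10 (.lit 0)))))
  (.loop (.intLe (.reg 3) (.reg 0))
    (.seq (.seq (.writeInt 2 (.reg 3) (.reg 9)) (.seq (.writeInt 3 (.reg 3) (.reg 10))
      (.seq (.setInt 8 (.plus (.reg 8) (.reg 1))) (.setInt 3 (.plus (.reg 3) (.lit 1))))))
      (.branch (.intLe (.plus (.reg 0) (.lit 1)) (.reg 8))
        (.seq (.setInt 8 (.minus (.reg 8) (.plus (.reg 0) (.lit 1))))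
          (.seq (.setInt 9 (.plus (.reg 9) (.lit 1))) (.setInt 10 (.plus (.reg 10) (.reg 1)))))
        .skip)))

theorem runs_cellProg (s : Store) (hm : s.intReg 1 ≤ s.intReg 0) :
    Runs cellProg s (60 * s.intReg 0 + 100) fun s' => ∀ r ≤ s.intReg 0,
      s'.intArr 2 r = r * s.intReg 1 / (s.intReg 0 + 1) ∧
      s'.intArr 3 r = r * s.intReg 1 / (s.intReg 0 + 1) * s.intReg 1 := by
  set n := s.intReg 0 with hn
  set m := s.intReg 1 with hm'
  let I : ℕ → Store → Prop := fun k s' => (s'.intReg 0 = n ∧ s'.intReg 1 = m) ∧ s'.intReg 3 = k ∧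
    (s'.intReg 9 * (n + 1) + s'.intReg 8 = k * m ∧ s'.intReg 8 < n + 1 ∧
    s'.intReg 10 = s'.intReg 9 * m) ∧ ∀ r < k, s'.intArr 2 r = r * m / (n + 1) ∧
      s'.intArr 3 r = r * m / (n + 1) * m
  refine Runs.mono (Runs.seq (R := I 0)
    (Runs.of_wp ?_) fun s₁ h₁ => Runs.loop I (n + 1) _
      (fun k hk s' h => ⟨?_, (Runs.of_wp ?_)⟩) (fun s' h => ?_) h₁) ?_
      fun s' h r hr => h.2.2.2 r (by omega)
  · simp [Prog.wp, I, Store.setIntReg, IntExpr.val, hn, hm']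
  · simp only [BoolExpr.Holds, IntExpr.val, h.1.1, h.2.1]; omega
  · obtain ⟨⟨e0, e1⟩, e3, ⟨e, h8, h10⟩, hr⟩ := h
    have hdiv : s'.intReg 9 = k * m / (n + 1) := by
      rw [← e, mul_comm, Nat.mul_add_div (by omega), Nat.div_eq_of_lt h8, add_zero]
    have tab : ∀ r < k + 1, Function.update (s'.intArr 2) k (s'.intReg 9) r = r * m / (n + 1) ∧
        Function.update (s'.intArr 3) k (s'.intReg 10) r = r * m / (n + 1) * m := by
      intro r hrk
      rcases eq_or_ne r k with rfl | hne
      · simp [← hdiv, h10]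
      · simpa [hne] using hr r (by omega)
    refine ⟨fun hb => ?_, fun hb => ?_⟩
    · simp [BoolExpr.Holds, Store.setIntReg, Store.setIntCell, IntExpr.val, e0, e1] at hb
      refine ⟨?_, ?_, ⟨?_, ?_, ?_⟩, ?_⟩
      · simp [Store.setIntReg, Store.setIntCell, e0, e1]
      · simp [Store.setIntReg, Store.setIntCell, IntExpr.val, e3]
      · simp [Store.setIntReg, Store.setIntCell, IntExpr.val, e0, e1, add_mul, ← e]
        omega
      · simp [Store.setIntReg, Store.setIntCell, IntExpr.val, e0, e1]
        omega
      · simp [Store.setIntReg, Store.setIntCell, IntExpr.val, e1, h10, add_mul]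
      · simpa [Store.setIntReg, Store.setIntCell, IntExpr.val, e3] using tab
    · simp [BoolExpr.Holds, Store.setIntReg, Store.setIntCell, IntExpr.val, e0, e1] at hb
      refine ⟨?_, ?_, ⟨?_, ?_, ?_⟩, ?_⟩
      · simp [Store.setIntReg, Store.setIntCell, e0, e1]
      · simp [Store.setIntReg, Store.setIntCell, IntExpr.val, e3]
      · simp [Store.setIntReg, Store.setIntCell, IntExpr.val, e1, add_mul, ← e]
        omega
      · simp [Store.setIntReg, Store.setIntCell, IntExpr.val, e1]
        omega
      · simp [Store.setIntReg, Store.setIntCell, h10]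
      · simpa [Store.setIntReg, Store.setIntCell, IntExpr.val, e3] using tab
  · simp only [BoolExpr.Holds, IntExpr.val, h.1.1, h.2.1]; omega
  · simp only [Prog.maxCost, IntExpr.cost, BoolExpr.cost]
    omega

/-! ### The counts and the quadratic form -/

/-- Counts the sample points per cell; cell `(i, j)` has the position `i m + j` in array `6`. -/
def countProg : Prog :=
  .seq (.setInt 3 (.lit 0))
  (.loop (.neg (.intLe (.reg 0) (.reg 3)))
    (.seq (.setInt 8 (.plus (.read 3 (.read 4 (.reg 3))) (.read 2 (.read 5 (.reg 3)))))
    (.seq (.writeInt 6 (.reg 8) (.plus (.read 6 (.reg 8)) (.lit 1)))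
      (.setInt 3 (.plus (.reg 3) (.lit 1))))))

theorem runs_countProg (s : Store) (h6 : s.intArr 6 = 0) :
    Runs countProg s (30 * s.intReg 0 + 20) fun s' => ∀ c,
      s'.intArr 6 c = ∑ k ∈ Finset.range (s.intReg 0),
        if s.intArr 3 (s.intArr 4 k) + s.intArr 2 (s.intArr 5 k) = c then 1 else 0 := by
  set n := s.intReg 0 with hn
  let I : ℕ → Store → Prop := fun k s' => (s'.intReg 0 = n ∧ s'.intArr 2 = s.intArr 2 ∧
    s'.intArr 3 = s.intArr 3 ∧ s'.intArr 4 = s.intArr 4 ∧ s'.intArr 5 = s.intArr 5) ∧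
    s'.intReg 3 = k ∧ ∀ c, s'.intArr 6 c = ∑ k ∈ Finset.range k,
        if s.intArr 3 (s.intArr 4 k) + s.intArr 2 (s.intArr 5 k) = c then 1 else 0
  refine Runs.mono (Runs.seq (R := I 0)
    (Runs.of_wp ?_) fun s₁ h₁ => Runs.loop I n _
      (fun k hk s' h => ⟨?_, (Runs.of_wp ?_)⟩) (fun s' h => ?_) h₁) ?_
      fun s' h => h.2.2
  · simp [Prog.wp, I, Store.setIntReg, IntExpr.val, hn, h6]
  · simp only [BoolExpr.Holds, IntExpr.val, h.1.1, h.2.1]; omega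
  · obtain ⟨⟨e0, e2, e3, e4, e5⟩, ek, hr⟩ := h
    refine ⟨?_, ?_, fun c => ?_⟩
    · simp [Store.setIntReg, Store.setIntCell, e0, e2, e3, e4, e5]
    · simp [Store.setIntReg, Store.setIntCell, IntExpr.val, ek]
    · simp only [Store.setIntReg, Store.setIntCell, IntExpr.val, ek, e2, e3, e4, e5,
        Function.update_self, Finset.sum_range_succ, ← hr]
      set d := s.intArr 3 (s.intArr 4 k) + s.intArr 2 (s.intArr 5 k)
      rcases eq_or_ne c d with rfl | hne
      · simp
      · simp [hne, hne.symm]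
  · simp only [BoolExpr.Holds, IntExpr.val, h.1.1, h.2.1]; omega
  · simp only [Prog.maxCost, IntExpr.cost, BoolExpr.cost]
    omega

/-- The contribution of the entry `d` of the checkerboard matrix to the estimator, where `s` is the
sum of the entries to its left. -/
noncomputable def xiTerm (s d : ℝ) : ℝ := 6 * (s * s + s * d + d * d / 3) + d * d / 2

/-- Evaluates the quadratic form from the counts, with running row sums. -/
def evalProg : Prog :=
  .seq (.seq (.setInt 4 (.lit 0)) (.seq (.setInt 10 (.lit 0)) (.setReal 2 (.ofInt (.lit 0)))))
  (.seq (.loop (.neg (.intLe (.reg 1) (.reg 4)))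
    (.seq (.seq (.setInt 6 (.lit 0)) (.setReal 3 (.ofInt (.lit 0))))
    (.seq (.loop (.neg (.intLe (.reg 1) (.reg 6)))
      (.seq (.setReal 4 (.over (.ofInt (.read 6 (.plus (.reg 10) (.reg 6)))) (.ofInt (.reg 0))))
      (.seq (.setReal 2 (.plus (.reg 2)
        (.plus (.times (.ofInt (.lit 6))
          (.plus (.plus (.times (.reg 3) (.reg 3)) (.times (.reg 3) (.reg 4)))
            (.over (.times (.reg 4) (.reg 4)) (.ofInt (.lit 3)))))
          (.over (.times (.reg 4) (.reg 4)) (.ofInt (.lit 2))))))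
      (.seq (.setReal 3 (.plus (.reg 3) (.reg 4))) (.setInt 6 (.plus (.reg 6) (.lit 1)))))))
    (.seq (.setInt 10 (.plus (.reg 10) (.reg 1))) (.setInt 4 (.plus (.reg 4) (.lit 1)))))))
  (.setReal 0 (.minus (.reg 2) (.ofInt (.lit 2)))))

theorem runs_evalProg (s : Store) (d : ℕ → ℕ → ℝ)
    (hd : ∀ i j, (s.intArr 6 (i * s.intReg 1 + j) : ℝ) / s.intReg 0 = d i j) :
    Runs evalProg s (s.intReg 1 * (s.intReg 1 * 60 + 50) + 40) fun s' =>
      s'.realReg 0 = ∑ i ∈ Finset.range (s.intReg 1), ∑ j ∈ Finset.range (s.intReg 1),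
        xiTerm (∑ l ∈ Finset.range j, d i l) (d i j) - 2 := by
  set n := s.intReg 0 with hn
  set m := s.intReg 1 with hm
  let F : Store → Prop := fun s' => s'.intReg 0 = n ∧ s'.intReg 1 = m ∧ s'.intArr 6 = s.intArr 6
  let R : ℕ → ℕ → ℝ := fun i k => ∑ j ∈ Finset.range k, xiTerm (∑ l ∈ Finset.range j, d i l) (d i j)
  let I : ℕ → Store → Prop := fun i s' => F s' ∧ s'.intReg 4 = i ∧ s'.intReg 10 = i * m ∧
    s'.realReg 2 = ∑ i ∈ Finset.range i, R i m
  let J : ℕ → ℕ → Store → Prop := fun i j s' => F s' ∧ s'.intReg 4 = i ∧ s'.intReg 10 = i * m ∧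
    s'.intReg 6 = j ∧ s'.realReg 3 = ∑ l ∈ Finset.range j, d i l ∧
    s'.realReg 2 = ∑ i ∈ Finset.range i, R i m + R i j
  refine Runs.mono (Runs.seq (R := I 0)
    (Runs.of_wp ?_) fun s₁ h₁ => Runs.seq (R := I m) (Runs.loop I m (m * 60 + 40)
      (fun i hk s' h => ⟨?_, ?_⟩) (fun s' h => ?_) h₁)
      fun s₂ h₂ => Runs.of_wp ?_) ?_
      fun s' h => h
  · simp [Prog.wp, I, F, Store.setIntReg, Store.setRealReg, IntExpr.val, RealExpr.val, hn, hm]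
  · simp only [BoolExpr.Holds, IntExpr.val, h.1.2.1, h.2.1]; omega
  · refine Runs.mono (Runs.seq (R := J i 0)
      (Runs.of_wp ?_) fun s₁ h₁ => Runs.seq (R := J i m) (Runs.loop (J i) m _
        (fun j hk s' h => ⟨?_, Runs.of_wp ?_⟩) (fun s' h => ?_) h₁)
        fun s₂ h₂ => Runs.of_wp (Q := I (i + 1)) ?_) ?_
        fun s' h => h
    · obtain ⟨⟨e0, e1, e6⟩, e4, e10, e2⟩ := h
      simp [Prog.wp, J, F, R, Store.setIntReg, Store.setRealReg, IntExpr.val, RealExpr.val, e0, e1,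
        e6, e4, e10, e2]
    · simp only [BoolExpr.Holds, IntExpr.val, h.1.2.1, h.2.2.2.1]; omega
    · obtain ⟨⟨e0, e1, e6⟩, e4, e10, ej, e3, e2⟩ := h
      simp [Prog.wp, J, F, R, Store.setIntReg, Store.setRealReg, IntExpr.val, RealExpr.val, e0, e1,
        e6, e4, e10, e2, e3, ej, hd, Finset.sum_range_succ, xiTerm, add_assoc]
    · simp only [BoolExpr.Holds, IntExpr.val, h.1.2.1, h.2.2.2.1]; omega
    · obtain ⟨⟨e0, e1, e6⟩, e4, e10, ej, e3, e2⟩ := h₂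
      simp [Prog.wp, I, F, Store.setIntReg, IntExpr.val, e0, e1,
        e6, e4, e10, e2, Finset.sum_range_succ, add_mul]
    · simp only [Prog.maxCost, IntExpr.cost, BoolExpr.cost, RealExpr.cost]
      omega
  · simp only [BoolExpr.Holds, IntExpr.val, h.1.2.1, h.2.1]; omega
  · simp [Store.setRealReg, RealExpr.val, IntExpr.val, h₂.2.2.2, R, Prog.wp]
  · simp only [Prog.maxCost, IntExpr.cost, BoolExpr.cost, RealExpr.cost]
    ring_nf
    omega

/-! ### The estimator in terms of row sums -/

theorem xiOfMatrix_eq_sum {m : ℕ} (D : Matrix (Fin m) (Fin m) ℝ) (d : ℕ → ℕ → ℝ)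
    (hd : ∀ i j : Fin m, D i j = d i j) :
    xiOfMatrix D = ∑ i ∈ Finset.range m, ∑ j ∈ Finset.range m,
      xiTerm (∑ l ∈ Finset.range j, d i l) (d i j) - 2 := by
  set T := upperOnes m with hT
  have htr : ∀ A B : Matrix (Fin m) (Fin m) ℝ,
      (A.transpose * B).trace = ∑ i, ∑ j, A i j * B i j := by
    intro A B
    simp only [Matrix.trace, Matrix.diag_apply, Matrix.mul_apply, Matrix.transpose_apply]
    exact Finset.sum_comm
  have hDT : ∀ i j : Fin m, (D * T) i j = ∑ l ∈ Finset.range j, d i l := by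
    intro i j
    have h1 : (D * T) i j = ∑ l : Fin m, (fun l : ℕ => if l < j then d i l else 0) l := by
      rw [Matrix.mul_apply]
      refine Finset.sum_congr rfl fun l _ => ?_
      simp [hT, upperOnes, hd]
    rw [h1, ← Finset.sum_range (fun l : ℕ => if l < j then d i l else 0), ← Finset.sum_filter]
    congr 1
    ext l
    have := j.2
    simp only [Finset.mem_filter, Finset.mem_range]
    omega
  have e1 : (D.transpose * D * (T * T.transpose)).trace = ∑ i, ∑ j, (D * T) i j * (D * T) i j := by
    rw [← htr, Matrix.transpose_mul, ← Matrix.mul_assoc, Matrix.trace_mul_comm]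
    simp only [Matrix.mul_assoc]
  have e2 : (D.transpose * D * T.transpose).trace = ∑ i, ∑ j, (D * T) i j * D i j := by
    rw [← htr, Matrix.transpose_mul, Matrix.trace_mul_comm]
    simp only [Matrix.mul_assoc]
  have e3 : (D.transpose * D * xiMatrix m).trace = ∑ i, ∑ j, (D * T) i j * (D * T) i j +
      ∑ i, ∑ j, (D * T) i j * D i j + 1 / 3 * ∑ i, ∑ j, D i j * D i j := by
    rw [xiMatrix, Matrix.mul_add, Matrix.mul_add, Matrix.trace_add, Matrix.trace_add, e1, e2,
      Matrix.mul_smul, Matrix.mul_one, Matrix.trace_smul, htr, smul_eq_mul]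
  rw [xiOfMatrix, e3, htr, Finset.sum_range]
  simp only [Finset.sum_range (n := m), ← hDT, ← hd, xiTerm, Finset.sum_add_distrib, ← Finset.mul_sum,
    ← Finset.sum_div]
  ring

/-- The entries of the empirical checkerboard matrix as relative frequencies of cells that are
described by integer division. -/
theorem empiricalCheckerboard_apply {n m : ℕ} (x y : Fin n → ℝ) (i j : Fin m) :
    empiricalCheckerboard m x y i j = (∑ k : Fin n,
      if sampleRank x k * m / (n + 1) = i ∧ sampleRank y k * m / (n + 1) = j then (1 : ℝ) else 0)
        / n := by
  have hm : 0 < m := i.pos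
  have key : ∀ r c : ℕ, ((r : ℝ) / ((n : ℝ) + 1) ∈ Set.Ico ((c : ℝ) / m) (((c : ℝ) + 1) / m)) ↔
      r * m / (n + 1) = c := by
    intro r c
    have hm' : (0 : ℝ) < m := by exact_mod_cast hm
    have hn' : (0 : ℝ) < (n : ℝ) + 1 := by positivity
    rw [Set.mem_Ico, div_le_div_iff₀ hm' hn', div_lt_div_iff₀ hn' hm']
    rw [Nat.div_eq_iff (by omega)]
    have e1 : ((c : ℝ) * ((n : ℝ) + 1) ≤ r * m) ↔ c * (n + 1) ≤ r * m := by exact_mod_cast Iff.rfl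
    have e2 : ((r : ℝ) * m < ((c : ℝ) + 1) * ((n : ℝ) + 1)) ↔ r * m < (c + 1) * (n + 1) := by
      exact_mod_cast Iff.rfl
    rw [e1, e2, add_one_mul c]
    omega
  rw [empiricalCheckerboard, Matrix.of_apply, one_div, inv_mul_eq_div]
  congr 1
  refine Finset.sum_congr rfl fun k _ => ?_
  simp only [gridSquare, Set.indicator_apply, Set.mem_prod, pseudoObs, key, Pi.one_apply]

theorem sampleRank_le {n : ℕ} (x : Fin n → ℝ) (k : Fin n) : sampleRank x k ≤ n :=
  (Finset.card_le_univ _).trans (by simp)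

theorem cell_lt {n m r : ℕ} (hm : 0 < m) (hr : r ≤ n) : r * m / (n + 1) < m := by
  rw [Nat.div_lt_iff_lt_mul (by omega), mul_comm]
  exact Nat.mul_lt_mul_of_pos_left (by omega) hm

theorem gridSize_sq_le {κ : ℝ} (hκ : κ ≤ 1 / 3) {n : ℕ} (hn : 1 ≤ n) :
    ⌊(n : ℝ) ^ κ⌋₊ ^ 2 ≤ n := by
  have h1 : (1 : ℝ) ≤ n := by exact_mod_cast hn
  have h2 : (⌊(n : ℝ) ^ κ⌋₊ : ℝ) ≤ (n : ℝ) ^ (1 / 2 : ℝ) :=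
    (Nat.floor_le (by positivity)).trans (Real.rpow_le_rpow_of_exponent_le h1 (by linarith))
  have h3 : (⌊(n : ℝ) ^ κ⌋₊ : ℝ) ^ (2 : ℕ) ≤ (n : ℝ) := by
    refine (pow_le_pow_left₀ (by positivity) h2 2).trans_eq ?_
    rw [← Real.sqrt_eq_rpow, Real.sq_sqrt (by linarith)]
  exact_mod_cast h3

theorem one_le_gridSize {κ : ℝ} (hκ : 0 ≤ κ) {n : ℕ} (hn : 1 ≤ n) : 1 ≤ ⌊(n : ℝ) ^ κ⌋₊ := by
  rw [Nat.one_le_floor_iff]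
  exact Real.one_le_rpow (by exact_mod_cast hn) hκ

/-! ### The program for the estimator -/

/-- Sorts and ranks both samples, then bins the ranks and evaluates the quadratic form. -/
def xiProg : Prog :=
  .seq (sortProg 0) (.seq (rankProg 0 4) (.seq (sortProg 1) (.seq (rankProg 1 5)
    (.seq gridSizeProg (.seq cellProg (.seq countProg evalProg))))))

theorem runs_xiProg {κ : ℝ} (hκ₀ : 0 ≤ κ) (hκ : κ ≤ 1 / 3) {n : ℕ} (hn : 1 ≤ n)
    (x y : Fin n → ℝ) :
    Runs xiProg (initStore κ x y) (1000 * (n * (Nat.clog 2 n + 1)))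
      fun s' => s'.realReg 0 = xiEstimator κ x y := by
  set s := initStore κ x y with hs
  set m := ⌊(n : ℝ) ^ κ⌋₊ with hm
  set L := Nat.clog 2 n with hL
  have hm1 : 1 ≤ m := one_le_gridSize hκ₀ hn
  have hm2 : m ^ 2 ≤ n := gridSize_sq_le hκ hn
  have hmn : m ≤ n := (Nat.le_self_pow two_ne_zero m).trans hm2
  have s0 : s.intReg 0 = n := by simp [hs, initStore]
  have sx : ∀ i : Fin n, s.realArr 0 i = x i := fun i => by simp [hs, initStore]
  have sy : ∀ i : Fin n, s.realArr 1 i = y i := fun i => by simp [hs, initStore]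
  refine Runs.mono (t := (L * (113 * n + 40) + 12 * n + 20) + ((40 * n + 20) +
    ((L * (113 * n + 40) + 12 * n + 20) + ((40 * n + 20) + ((15 * m + 20) + ((60 * n + 100) +
    ((30 * n + 20) + (m * (m * 60 + 50) + 40)))))))) ?_ ?_ fun _ h => h
  · have r₁ := (runs_sortProg 0 s).framed
    rw [s0] at r₁
    refine r₁.seq fun s₁ ⟨⟨hp₁, hq₁⟩, f₁⟩ => ?_
    have a0 := (f₁.intReg 0 (by
      simp [sortProg, mergeProg, fillProg, copyProg, Prog.WritesIntReg])).trans s0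
    have aR := fun a => f₁.realArr a (by
      simp [sortProg, mergeProg, fillProg, copyProg, Prog.WritesRealArr])
    have aA := fun a (h0 : a ≠ 0) (h1 : a ≠ 1) => f₁.intArr a (by
      simp [sortProg, mergeProg, fillProg, copyProg, Prog.WritesIntArr, h0, h1])
    have ar := fun a => f₁.realReg a (by
      simp [sortProg, mergeProg, fillProg, copyProg, Prog.WritesRealReg])
    have r₂ := (runs_rankProg 0 4 (by norm_num) s₁ (by rwa [a0]) (by rwa [a0, aR])).framed
    rw [a0, aR] at r₂
    refine r₂.seq fun s₂ ⟨h₂, f₂⟩ => ?_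
    have b0 := (f₂.intReg 0 (by simp [rankProg, Prog.WritesIntReg])).trans a0
    have bR := fun a => (f₂.realArr a (by simp [rankProg, Prog.WritesRealArr])).trans (aR a)
    have bA := fun a (h0 : a ≠ 0) (h1 : a ≠ 1) (h4 : a ≠ 4) =>
      (f₂.intArr a (by simp [rankProg, Prog.WritesIntArr, h4])).trans (aA a h0 h1)
    have br := fun a => (f₂.realReg a (by simp [rankProg, Prog.WritesRealReg])).trans (ar a)
    have r₃ := (runs_sortProg 1 s₂).framed
    rw [b0] at r₃
    refine r₃.seq fun s₃ ⟨⟨hp₃, hq₃⟩, f₃⟩ => ?_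
    have c0 := (f₃.intReg 0 (by
      simp [sortProg, mergeProg, fillProg, copyProg, Prog.WritesIntReg])).trans b0
    have cR := fun a => (f₃.realArr a (by
      simp [sortProg, mergeProg, fillProg, copyProg, Prog.WritesRealArr])).trans (bR a)
    have cA := fun a (h0 : a ≠ 0) (h1 : a ≠ 1) => f₃.intArr a (by
      simp [sortProg, mergeProg, fillProg, copyProg, Prog.WritesIntArr, h0, h1])
    have cr := fun a => (f₃.realReg a (by
      simp [sortProg, mergeProg, fillProg, copyProg, Prog.WritesRealReg])).trans (br a)
    have r₄ := (runs_rankProg 1 5 (by norm_num) s₃ (by rwa [c0])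
      (by rw [bR] at hq₃; rwa [c0, cR])).framed
    rw [c0, cR] at r₄
    refine r₄.seq fun s₄ ⟨h₄, f₄⟩ => ?_
    have d0 := (f₄.intReg 0 (by simp [rankProg, Prog.WritesIntReg])).trans c0
    have dr := fun a => (f₄.realReg a (by simp [rankProg, Prog.WritesRealReg])).trans (cr a)
    have d4 := (f₄.intArr 4 (by simp [rankProg, Prog.WritesIntArr])).trans
      (cA 4 (by norm_num) (by norm_num))
    have d6 := ((f₄.intArr 6 (by simp [rankProg, Prog.WritesIntArr])).trans
      (cA 6 (by norm_num) (by norm_num))).trans (bA 6 (by norm_num) (by norm_num) (by norm_num))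
    have hX : ∀ k : Fin n, s₄.intArr 4 k = sampleRank x k := fun k => by
      rw [d4, h₂ k k.2, sampleRank_eq_rankBelow x _ sx]
    have hY : ∀ k : Fin n, s₄.intArr 5 k = sampleRank y k := fun k => by
      rw [h₄ k k.2, sampleRank_eq_rankBelow y _ sy]
    have r₅ := (runs_gridSizeProg s₄).framed
    have hκ' : s₄.realReg 0 = κ := (dr 0).trans (by simp [hs, initStore])
    rw [d0, hκ', ← hm] at r₅
    refine r₅.seq fun s₅ ⟨e1, f₅⟩ => ?_
    have e0 := (f₅.intReg 0 (by simp [gridSizeProg, Prog.WritesIntReg])).trans d0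
    have eA := fun a => f₅.intArr a (by simp [gridSizeProg, Prog.WritesIntArr])
    have r₆ := (runs_cellProg s₅ (by rwa [e0, e1])).framed
    rw [e0, e1] at r₆
    refine r₆.seq fun s₆ ⟨h₆, f₆⟩ => ?_
    have g0 := (f₆.intReg 0 (by simp [cellProg, Prog.WritesIntReg])).trans e0
    have g1 := (f₆.intReg 1 (by simp [cellProg, Prog.WritesIntReg])).trans e1
    have gA := fun a (h2 : a ≠ 2) (h3 : a ≠ 3) =>
      (f₆.intArr a (by simp [cellProg, Prog.WritesIntArr, h2, h3])).trans (eA a)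
    have r₇ := (runs_countProg s₆ (by
      rw [gA 6 (by norm_num) (by norm_num), d6]; simp [hs, initStore]; rfl)).framed
    rw [g0] at r₇
    refine r₇.seq fun s₇ ⟨h₇, f₇⟩ => ?_
    have i0 := (f₇.intReg 0 (by simp [countProg, Prog.WritesIntReg])).trans g0
    have i1 := (f₇.intReg 1 (by simp [countProg, Prog.WritesIntReg])).trans g1
    have r₈ := runs_evalProg s₇ (fun i j => (s₇.intArr 6 (i * m + j) : ℝ) / n)
      (fun i j => by rw [i0, i1])
    rw [i1] at r₈
    refine r₈.mono le_rfl fun s₈ h₈ => ?_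
    rw [h₈, xiEstimator]
    symm
    refine xiOfMatrix_eq_sum _ _ fun i j => ?_
    rw [empiricalCheckerboard_apply, h₇, Finset.sum_range]
    push_cast
    congr 1
    refine Finset.sum_congr rfl fun k _ => ?_
    rw [gA 4 (by norm_num) (by norm_num), gA 5 (by norm_num) (by norm_num), hX, hY,
      (h₆ _ (sampleRank_le x k)).2, (h₆ _ (sampleRank_le y k)).1]
    have c1 := cell_lt hm1 (sampleRank_le x k)
    have c2 := cell_lt hm1 (sampleRank_le y k)
    have hj := j.2
    refine if_congr ⟨fun h => by rw [h.1, h.2], fun h => ?_⟩ rfl rfl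
    generalize sampleRank x k * m / (n + 1) = a at *
    generalize sampleRank y k * m / (n + 1) = b at *
    -- The remainder modulo `m` recovers the column, hence also the row.
    have r := congrArg (· % m) h
    simp only [Nat.mul_add_mod', Nat.mod_eq_of_lt c2] at r
    rw [Nat.mod_eq_of_lt hj] at r
    rw [r] at h
    exact ⟨Nat.eq_of_mul_eq_mul_right hm1 (Nat.add_right_cancel h), r⟩
  · have h1 : L ≤ L * n := Nat.le_mul_of_pos_right L hn
    have h2 : m * (m * 60 + 50) = 60 * m ^ 2 + 50 * m := by ring
    have h3 : L * (113 * n + 40) = 113 * (L * n) + 40 * L := by ring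
    have h4 : 1000 * (n * (L + 1)) = 1000 * (L * n) + 1000 * n := by ring
    rw [h2, h3, h4]
    omega

theorem isBigO_clog : (fun n : ℕ => ((1000 * (n * (Nat.clog 2 n + 1)) : ℕ) : ℝ)) =O[atTop]
    fun n : ℕ => (n : ℝ) * Real.log n := by
  refine Asymptotics.IsBigO.of_bound 4000 ?_
  filter_upwards [eventually_ge_atTop 3] with n hn
  have hn' : (3 : ℝ) ≤ n := by exact_mod_cast hn
  have hlog : 1 ≤ Real.log n := by
    rw [Real.le_log_iff_exp_le (by linarith)]
    linarith [Real.exp_one_lt_d9]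
  have hc : (Nat.clog 2 n : ℝ) < 2 * Real.log n + 1 := by
    have h1 := Real.natCeil_logb_natCast 2 n
    have h0 : 0 ≤ Real.logb 2 n := Real.logb_nonneg (by norm_num) (by linarith)
    have h2 := Nat.ceil_lt_add_one h0
    push_cast at h1
    rw [h1] at h2
    have h3 : Real.logb 2 n ≤ 2 * Real.log n := by
      rw [Real.logb, div_le_iff₀ (Real.log_pos (by norm_num))]
      nlinarith [Real.log_two_gt_d9]
    linarith
  rw [Real.norm_of_nonneg (by positivity), Real.norm_of_nonneg (by positivity)]
  push_cast
  have : (n : ℝ) * (Nat.clog 2 n + 1) ≤ n * (4 * Real.log n) := by gcongr; linarith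
  nlinarith

/-! ### Increments of copulas -/

namespace IsCopula

variable {C : ℝ → ℝ → ℝ}

theorem increment_mono (hC : IsCopula C) {u u' v v' : ℝ} (hu : 0 ≤ u) (huu : u ≤ u') (hu' : u' ≤ 1)
    (hv : 0 ≤ v) (hvv : v ≤ v') (hv' : v' ≤ 1) : C u' v - C u v ≤ C u' v' - C u v' := by
  have := hC.two_increasing u u' v v' hu huu hu' hv hvv hv'
  linarith

theorem increment_nonneg (hC : IsCopula C) {u u' v : ℝ} (hu : 0 ≤ u) (huu : u ≤ u') (hu' : u' ≤ 1)
    (hv : 0 ≤ v) (hv' : v ≤ 1) : 0 ≤ C u' v - C u v := by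
  have := hC.increment_mono hu huu hu' le_rfl hv hv'
  rw [hC.grounded_right u' ⟨hu.trans huu, hu'⟩, hC.grounded_right u ⟨hu, huu.trans hu'⟩] at this
  linarith

theorem increment_le (hC : IsCopula C) {u u' v : ℝ} (hu : 0 ≤ u) (huu : u ≤ u') (hu' : u' ≤ 1)
    (hv : 0 ≤ v) (hv' : v ≤ 1) : C u' v - C u v ≤ u' - u := by
  have := hC.increment_mono hu huu hu' hv hv' le_rfl
  rwa [hC.margin_left u' ⟨hu.trans huu, hu'⟩, hC.margin_left u ⟨hu, huu.trans hu'⟩] at this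

theorem swap (hC : IsCopula C) : IsCopula fun u v => C v u where
  mem_unit u hu v hv := hC.mem_unit v hv u hu
  grounded_left v hv := hC.grounded_right v hv
  grounded_right u hu := hC.grounded_left u hu
  margin_left u hu := hC.margin_right u hu
  margin_right v hv := hC.margin_left v hv
  two_increasing u₁ v₁ u₂ v₂ h1 h2 h3 h4 h5 h6 := by
    have := hC.two_increasing u₂ v₂ u₁ v₁ h4 h5 h6 h1 h2 h3
    linarith

theorem abs_increment_le (hC : IsCopula C) {u u' v : ℝ} (hu : u ∈ Set.Icc (0 : ℝ) 1)
    (hu' : u' ∈ Set.Icc (0 : ℝ) 1) (hv : v ∈ Set.Icc (0 : ℝ) 1) :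
    |C u' v - C u v| ≤ |u' - u| := by
  rcases le_total u u' with h | h
  · rw [abs_of_nonneg (hC.increment_nonneg hu.1 h hu'.2 hv.1 hv.2), abs_of_nonneg (by linarith)]
    exact hC.increment_le hu.1 h hu'.2 hv.1 hv.2
  · rw [abs_sub_comm, abs_sub_comm u',
      abs_of_nonneg (hC.increment_nonneg hu'.1 h hu.2 hv.1 hv.2), abs_of_nonneg (by linarith)]
    exact hC.increment_le hu'.1 h hu.2 hv.1 hv.2

theorem abs_sub_le (hC : IsCopula C) {u u' v v' : ℝ} (hu : u ∈ Set.Icc (0 : ℝ) 1)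
    (hu' : u' ∈ Set.Icc (0 : ℝ) 1) (hv : v ∈ Set.Icc (0 : ℝ) 1) (hv' : v' ∈ Set.Icc (0 : ℝ) 1) :
    |C u' v' - C u v| ≤ |u' - u| + |v' - v| := by
  have h1 := hC.abs_increment_le hu hu' hv'
  have h2 := hC.swap.abs_increment_le hv hv' hu
  calc |C u' v' - C u v| = |(C u' v' - C u v') + (C u v' - C u v)| := by ring_nf
    _ ≤ _ := (abs_add_le _ _).trans (add_le_add h1 h2)

end IsCopula

/-- The nearest point of the unit interval. -/
noncomputable def unitClamp (t : ℝ) : ℝ := max 0 (min 1 t)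

theorem unitClamp_mem (t : ℝ) : unitClamp t ∈ Set.Icc (0 : ℝ) 1 :=
  ⟨le_max_left _ _, max_le zero_le_one (min_le_left _ _)⟩

theorem unitClamp_of_mem {t : ℝ} (h : t ∈ Set.Icc (0 : ℝ) 1) : unitClamp t = t := by
  rw [unitClamp, min_eq_right h.2, max_eq_right h.1]

theorem unitClamp_mono : Monotone unitClamp := fun s t h => by
  unfold unitClamp
  gcongr

theorem abs_unitClamp_sub_le (s t : ℝ) : |unitClamp s - unitClamp t| ≤ |s - t| := by
  unfold unitClamp
  refine (abs_max_sub_max_le_max 0 _ 0 _).trans (max_le (by simp) ?_)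
  refine (abs_min_sub_min_le_max 1 _ 1 _).trans (max_le (by simp) le_rfl)

/-- A copula, extended to the plane so that it is constant outside the unit square in the directions
normal to its boundary. The extension is Lipschitz and all its increments are nonnegative. -/
noncomputable def copulaExtend (C : ℝ → ℝ → ℝ) (u v : ℝ) : ℝ := C (unitClamp u) (unitClamp v)

namespace IsCopula

variable {C : ℝ → ℝ → ℝ}

theorem extend_monotone (hC : IsCopula C) (v : ℝ) : Monotone fun u => copulaExtend C u v :=
  fun u u' h => sub_nonneg.1 (hC.increment_nonneg (unitClamp_mem u).1 (unitClamp_mono h)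
    (unitClamp_mem u').2 (unitClamp_mem v).1 (unitClamp_mem v).2)

theorem extend_abs_sub_le (hC : IsCopula C) (u u' v v' : ℝ) :
    |copulaExtend C u' v' - copulaExtend C u v| ≤ |u' - u| + |v' - v| :=
  (hC.abs_sub_le (unitClamp_mem u) (unitClamp_mem u') (unitClamp_mem v) (unitClamp_mem v')).trans
    (add_le_add (abs_unitClamp_sub_le _ _) (abs_unitClamp_sub_le _ _))

theorem extend_lipschitz (hC : IsCopula C) (v : ℝ) :
    LipschitzWith 1 fun u => copulaExtend C u v :=
  LipschitzWith.of_dist_le_mul fun u u' => by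
    simpa [Real.dist_eq] using hC.extend_abs_sub_le u' u v v

theorem extend_continuous (hC : IsCopula C) :
    Continuous fun p : ℝ × ℝ => copulaExtend C p.2 p.1 := by
  have : LipschitzWith 2 fun p : ℝ × ℝ => copulaExtend C p.2 p.1 := by
    refine LipschitzWith.of_dist_le_mul fun p q => ?_
    have h := hC.extend_abs_sub_le q.2 p.2 q.1 p.1
    rw [Prod.dist_eq, Real.dist_eq, Real.dist_eq, Real.dist_eq]
    have h1 := le_max_left |p.1 - q.1| |p.2 - q.2|
    have h2 := le_max_right |p.1 - q.1| |p.2 - q.2|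
    push_cast
    linarith
  exact this.continuous

theorem extend_increment_mono (hC : IsCopula C) {u u' : ℝ} (h : u ≤ u') :
    Monotone fun v => copulaExtend C u' v - copulaExtend C u v :=
  fun v v' hv => hC.increment_mono (unitClamp_mem u).1 (unitClamp_mono h) (unitClamp_mem u').2
    (unitClamp_mem v).1 (unitClamp_mono hv) (unitClamp_mem v').2

theorem extend_increment_mem (hC : IsCopula C) {u u' : ℝ} (h : u ≤ u') (v : ℝ) :
    copulaExtend C u' v - copulaExtend C u v ∈ Set.Icc 0 (u' - u) := by
  refine ⟨sub_nonneg.2 (hC.extend_monotone v h), (le_abs_self _).trans ?_⟩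
  simpa [abs_of_nonneg (sub_nonneg.2 h)] using hC.extend_abs_sub_le u u' v v

end IsCopula

theorem copulaExtend_of_mem (C : ℝ → ℝ → ℝ) {u v : ℝ} (hu : u ∈ Set.Icc (0 : ℝ) 1)
    (hv : v ∈ Set.Icc (0 : ℝ) 1) : copulaExtend C u v = C u v := by
  rw [copulaExtend, unitClamp_of_mem hu, unitClamp_of_mem hv]

/-! ### Discretization of the derivative integral -/

theorem isBigO_floor_mul_div_sub (x : ℝ) (hx : 0 ≤ x) :
    (fun m : ℕ => (⌊m * x⌋₊ : ℝ) / m - x) =O[atTop] (fun m : ℕ => (1 : ℝ) / m) ∧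
    (fun m : ℕ => ((⌊m * x⌋₊ : ℝ) + 1) / m - x) =O[atTop] (fun m : ℕ => (1 : ℝ) / m) := by
  constructor
  all_goals
    refine Asymptotics.IsBigO.of_bound 1 ?_
    filter_upwards [eventually_gt_atTop 0] with m hm
    have hm' : (0 : ℝ) < m := by exact_mod_cast hm
    have h1 := Nat.floor_le (mul_nonneg hm'.le hx)
    have h2 := Nat.lt_floor_add_one (m * x)
    rw [one_mul, Real.norm_eq_abs, Real.norm_of_nonneg (by positivity), abs_le, ← neg_div,
      le_sub_iff_add_le, sub_le_iff_le_add, le_div_iff₀ hm', div_le_iff₀ hm', add_mul, add_mul,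
      div_mul_cancel₀ _ hm'.ne', div_mul_cancel₀ _ hm'.ne']
    constructor <;> linarith

/-- Difference quotients over the grid cell containing the point converge to the derivative. -/
theorem HasDerivAt.tendsto_grid_quotient {f : ℝ → ℝ} {f' x : ℝ} (hf : HasDerivAt f f' x)
    (hx : 0 ≤ x) :
    Tendsto (fun m : ℕ => (m : ℝ) * (f (((⌊m * x⌋₊ : ℝ) + 1) / m) - f ((⌊m * x⌋₊ : ℝ) / m)))
      atTop (𝓝 f') := by
  obtain ⟨hA, hB⟩ := isBigO_floor_mul_div_sub x hx
  have h0 : Tendsto (fun m : ℕ => (1 : ℝ) / m) atTop (𝓝 0) := tendsto_one_div_atTop_nhds_zero_nat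
  have tA : Tendsto (fun m : ℕ => (⌊m * x⌋₊ : ℝ) / m) atTop (𝓝 x) := by
    simpa using (hA.trans_tendsto h0).add_const x
  have tB : Tendsto (fun m : ℕ => ((⌊m * x⌋₊ : ℝ) + 1) / m) atTop (𝓝 x) := by
    simpa using (hB.trans_tendsto h0).add_const x
  have hd := hasDerivAt_iff_isLittleO.1 hf
  have h := ((hd.comp_tendsto tB).trans_isBigO hB).sub ((hd.comp_tendsto tA).trans_isBigO hA)
  have h' := h.tendsto_div_nhds_zero.add_const f'
  rw [zero_add] at h'
  refine h'.congr' ?_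
  filter_upwards [eventually_gt_atTop 0] with m hm
  have hm' : (m : ℝ) ≠ 0 := by exact_mod_cast hm.ne'
  simp only [Function.comp, smul_eq_mul]
  field_simp
  ring

/-- The integral of a function of `⌊m x⌋` over the unit interval. -/
theorem integral_floor_mul {m : ℕ} (hm : 0 < m) (h : ℕ → ℝ) :
    ∫ x in (0 : ℝ)..1, h ⌊m * x⌋₊ = (∑ i ∈ Finset.range m, h i) / m := by
  have hm' : (0 : ℝ) < m := by exact_mod_cast hm
  have key : ∀ i : ℕ, Set.EqOn (fun x : ℝ => h ⌊m * x⌋₊) (fun _ => h i)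
      (Set.Ioo ((i : ℝ) / m) (((i + 1 : ℕ) : ℝ) / m)) := by
    intro i x hx
    have h1 := (div_lt_iff₀ hm').1 hx.1
    have h2 := (lt_div_iff₀ hm').1 hx.2
    have : ⌊m * x⌋₊ = i := by
      rw [Nat.floor_eq_iff (by nlinarith [(Nat.cast_nonneg i : (0 : ℝ) ≤ i)])]
      push_cast at h2
      constructor <;> linarith
    simp only [this]
  have hle : ∀ i : ℕ, (i : ℝ) / m ≤ ((i + 1 : ℕ) : ℝ) / m := fun i => by
    gcongr
    exact_mod_cast Nat.le_succ i
  have hae : ∀ i : ℕ, (fun x : ℝ => h ⌊m * x⌋₊) =ᵐ[volume.restrict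
      (Set.uIoc ((i : ℝ) / m) (((i + 1 : ℕ) : ℝ) / m))] fun _ => h i := by
    intro i
    rw [Set.uIoc_of_le (hle i), ← Measure.restrict_congr_set Ioo_ae_eq_Ioc]
    exact (ae_restrict_iff' measurableSet_Ioo).2 (.of_forall fun x hx => key i hx)
  have h1 : ∀ i : ℕ, ∫ x in ((i : ℝ) / m)..(((i + 1 : ℕ) : ℝ) / m), h ⌊m * x⌋₊ = h i / m := by
    intro i
    rw [intervalIntegral.integral_congr_ae_restrict (hae i), intervalIntegral.integral_const,
      smul_eq_mul]
    push_cast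
    field_simp
    ring
  have h2 := intervalIntegral.sum_integral_adjacent_intervals (n := m) (μ := volume)
    (a := fun i : ℕ => (i : ℝ) / m) (f := fun x : ℝ => h ⌊m * x⌋₊) fun i _ =>
    (intervalIntegrable_const (c := h i)).congr_ae (hae i).symm
  simp only [h1] at h2
  rw [Finset.sum_div, h2]
  simp [hm'.ne']

/-- Riemann sums of a monotone function with values in `[0, 1]` have error at most the mesh. -/
theorem abs_riemann_sub_integral_le {K : ℝ → ℝ} (hK : Monotone K) (h01 : ∀ x, K x ∈ Set.Icc 0 1)
    {m : ℕ} (hm : 0 < m) :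
    |(∑ j ∈ Finset.range m, K ((j : ℝ) / m)) / m - ∫ x in (0 : ℝ)..1, K x| ≤ 1 / m := by
  have hm' : (0 : ℝ) < m := by exact_mod_cast hm
  have hmono : Monotone fun t : ℝ => K (t / m) := fun s t h => hK (by gcongr)
  have h1 := (hmono.monotoneOn (Set.Icc (0 : ℝ) (0 + m))).sum_le_integral
  have h2 := (hmono.monotoneOn (Set.Icc (0 : ℝ) (0 + m))).integral_le_sum
  rw [intervalIntegral.integral_comp_div _ hm'.ne'] at h1 h2
  simp only [zero_add, zero_div, div_self hm'.ne', smul_eq_mul] at h1 h2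
  have h3 := Finset.sum_range_succ (fun j : ℕ => K ((j : ℝ) / m)) m
  have h4 := Finset.sum_range_succ' (fun j : ℕ => K ((j : ℝ) / m)) m
  have h5 := (h01 ((m : ℝ) / m)).2
  have h6 := (h01 (((0 : ℕ) : ℝ) / m)).1
  rw [abs_le, ← neg_div, le_sub_iff_add_le, sub_le_iff_le_add, ← sub_nonneg, ← sub_nonneg (b := _ / _)]
  constructor
  · rw [← mul_nonneg_iff_of_pos_left hm']
    have e : (m : ℝ) * ((∑ j ∈ Finset.range m, K ((j : ℝ) / m)) / m -
        (-1 / m + ∫ x in (0 : ℝ)..1, K x)) =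
        (∑ j ∈ Finset.range m, K ((j : ℝ) / m)) + 1 - m * ∫ x in (0 : ℝ)..1, K x := by
      field_simp
      ring
    rw [e]
    linarith
  · rw [← mul_nonneg_iff_of_pos_left hm']
    have e : (m : ℝ) * (1 / m + (∫ x in (0 : ℝ)..1, K x) -
        (∑ j ∈ Finset.range m, K ((j : ℝ) / m)) / m) =
        1 + m * (∫ x in (0 : ℝ)..1, K x) - (∑ j ∈ Finset.range m, K ((j : ℝ) / m)) := by
      field_simp
    rw [e]
    linarith

section

variable {C : ℝ → ℝ → ℝ}

/-- The integral over `u` of the squared difference quotients of a copula in its first argument,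
over the `m` cells of the unit interval. -/
noncomputable def gridEnergy (C : ℝ → ℝ → ℝ) (m : ℕ) (v : ℝ) : ℝ :=
  (∑ i ∈ Finset.range m, ((m : ℝ) * (copulaExtend C (((i : ℝ) + 1) / m) v -
    copulaExtend C ((i : ℝ) / m) v)) ^ 2) / m

theorem IsCopula.quotient_mem (hC : IsCopula C) (m i : ℕ) (v : ℝ) :
    (m : ℝ) * (copulaExtend C (((i : ℝ) + 1) / m) v - copulaExtend C ((i : ℝ) / m) v) ∈
      Set.Icc 0 1 := by
  have h := hC.extend_increment_mem (u := (i : ℝ) / m) (u' := ((i : ℝ) + 1) / m)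
    (by gcongr; linarith) v
  refine ⟨mul_nonneg (Nat.cast_nonneg m) h.1, ?_⟩
  calc _ ≤ (m : ℝ) * (((i : ℝ) + 1) / m - (i : ℝ) / m) :=
        mul_le_mul_of_nonneg_left h.2 (Nat.cast_nonneg m)
    _ = (m : ℝ) / m := by ring
    _ ≤ 1 := div_self_le_one _

theorem IsCopula.gridEnergy_mono (hC : IsCopula C) (m : ℕ) : Monotone (gridEnergy C m) := by
  intro v v' h
  refine div_le_div_of_nonneg_right (Finset.sum_le_sum fun i _ => ?_) (Nat.cast_nonneg m)
  exact pow_le_pow_left₀ (hC.quotient_mem m i v).1 (mul_le_mul_of_nonneg_left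
    (hC.extend_increment_mono (by gcongr; linarith) h) (Nat.cast_nonneg m)) 2

theorem IsCopula.gridEnergy_mem (hC : IsCopula C) (m : ℕ) (v : ℝ) :
    gridEnergy C m v ∈ Set.Icc 0 1 := by
  refine ⟨by unfold gridEnergy; positivity, ?_⟩
  refine div_le_one_of_le₀ ?_ (Nat.cast_nonneg m)
  calc _ ≤ ∑ i ∈ Finset.range m, (1 : ℝ) := Finset.sum_le_sum fun i _ =>
        pow_le_one₀ (hC.quotient_mem m i v).1 (hC.quotient_mem m i v).2
    _ = m := by simp

theorem IsCopula.abs_deriv_extend_le (hC : IsCopula C) (u v : ℝ) :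
    ‖deriv (fun s => copulaExtend C s v) u ^ 2‖ ≤ 1 := by
  rw [norm_pow]
  exact pow_le_one₀ (norm_nonneg _) (by simpa using norm_deriv_le_of_lipschitz (hC.extend_lipschitz v))

theorem IsCopula.tendsto_gridEnergy (hC : IsCopula C) (v : ℝ) :
    Tendsto (fun m => gridEnergy C m v) atTop
      (𝓝 (∫ u in (0 : ℝ)..1, deriv (fun s => copulaExtend C s v) u ^ 2)) := by
  have h : Tendsto (fun m : ℕ => ∫ u in (0 : ℝ)..1, ((m : ℝ) * (copulaExtend C
      (((⌊m * u⌋₊ : ℝ) + 1) / m) v - copulaExtend C ((⌊m * u⌋₊ : ℝ) / m) v)) ^ 2) atTop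
      (𝓝 (∫ u in (0 : ℝ)..1, deriv (fun s => copulaExtend C s v) u ^ 2)) := by
    refine intervalIntegral.tendsto_integral_filter_of_dominated_convergence (fun _ => 1)
      (.of_forall fun m => ?_) (.of_forall fun m => .of_forall fun u _ => ?_) (by simp) ?_
    · have hc : Measurable fun i : ℕ => ((m : ℝ) * (copulaExtend C
        (((i : ℝ) + 1) / m) v - copulaExtend C ((i : ℝ) / m) v)) ^ 2 := measurable_of_countable _
      exact (hc.comp (Nat.measurable_floor.comp (measurable_const_mul (m : ℝ)))).aestronglyMeasurable
    · have := hC.quotient_mem m ⌊m * u⌋₊ v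
      rw [norm_pow, Real.norm_of_nonneg this.1]
      exact pow_le_one₀ this.1 this.2
    · filter_upwards [(hC.extend_monotone v).ae_differentiableAt] with u hu hmem
      rw [Set.uIoc_of_le zero_le_one] at hmem
      exact (hu.hasDerivAt.tendsto_grid_quotient hmem.1.le).pow 2
  refine h.congr' ?_
  filter_upwards [eventually_gt_atTop 0] with m hm
  exact integral_floor_mul hm fun i => ((m : ℝ) * (copulaExtend C
        (((i : ℝ) + 1) / m) v - copulaExtend C ((i : ℝ) / m) v)) ^ 2

theorem IsCopula.integral_gridEnergy_tendsto (hC : IsCopula C) :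
    Tendsto (fun m => ∫ v in (0 : ℝ)..1, gridEnergy C m v) atTop
      (𝓝 (∫ v in (0 : ℝ)..1, ∫ u in (0 : ℝ)..1, deriv (fun s => copulaExtend C s v) u ^ 2)) := by
  refine intervalIntegral.tendsto_integral_filter_of_dominated_convergence (fun _ => 1)
    (.of_forall fun m => (hC.gridEnergy_mono m).measurable.aestronglyMeasurable)
    (.of_forall fun m => .of_forall fun v _ => ?_) (by simp)
    (.of_forall fun v _ => hC.tendsto_gridEnergy v)
  rw [Real.norm_of_nonneg (hC.gridEnergy_mem m v).1]
  exact (hC.gridEnergy_mem m v).2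

/-- The extension has the same derivative inside the square; in contrast to `C` itself it is jointly
continuous on the whole plane, which makes the derivative measurable. -/
theorem IsCopula.integral_deriv_sq_eq (hC : IsCopula C) :
    ∫ p in Set.Icc (0 : ℝ) 1 ×ˢ Set.Icc (0 : ℝ) 1, (deriv (fun s => C s p.2) p.1) ^ 2 =
      ∫ v in (0 : ℝ)..1, ∫ u in (0 : ℝ)..1, deriv (fun s => copulaExtend C s v) u ^ 2 := by
  have hset : (Set.Icc (0 : ℝ) 1 ×ˢ Set.Icc (0 : ℝ) 1 : Set (ℝ × ℝ)) =ᵐ[volume]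
      Set.Ioo (0 : ℝ) 1 ×ˢ Set.Ioo (0 : ℝ) 1 :=
    Measure.set_prod_ae_eq Ioo_ae_eq_Icc.symm Ioo_ae_eq_Icc.symm
  have hset' : (Set.Ioo (0 : ℝ) 1 ×ˢ Set.Ioo (0 : ℝ) 1 : Set (ℝ × ℝ)) =ᵐ[volume]
      Set.Ioc (0 : ℝ) 1 ×ˢ Set.Ioc (0 : ℝ) 1 :=
    Measure.set_prod_ae_eq Ioo_ae_eq_Ioc Ioo_ae_eq_Ioc
  have hcongr : Set.EqOn (fun p : ℝ × ℝ => (deriv (fun s => C s p.2) p.1) ^ 2)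
      (fun p : ℝ × ℝ => (deriv (fun s => copulaExtend C s p.2) p.1) ^ 2)
      (Set.Ioo (0 : ℝ) 1 ×ˢ Set.Ioo (0 : ℝ) 1) := by
    rintro ⟨u, v⟩ ⟨hu, hv⟩
    have : (fun s => C s v) =ᶠ[𝓝 u] fun s => copulaExtend C s v := by
      filter_upwards [Ioo_mem_nhds hu.1 hu.2] with s hs
      rw [copulaExtend_of_mem C (Set.Ioo_subset_Icc_self hs) (Set.Ioo_subset_Icc_self hv)]
    simp only [this.deriv_eq]
  have hmeas : Measurable fun p : ℝ × ℝ => (deriv (fun s => copulaExtend C s p.2) p.1) ^ 2 :=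
    ((measurable_deriv_with_param (𝕜 := ℝ) (f := fun v s => copulaExtend C s v)
      hC.extend_continuous).comp measurable_swap).pow_const 2
  rw [setIntegral_congr_set hset, setIntegral_congr_fun (by measurability) hcongr,
    setIntegral_congr_set hset', Measure.volume_eq_prod, ← Measure.prod_restrict,
    integral_prod_symm]
  · simp only [intervalIntegral.integral_of_le zero_le_one]
  · exact Integrable.of_bound hmeas.aestronglyMeasurable 1
      (.of_forall fun p => hC.abs_deriv_extend_le p.1 p.2)

/-- The squared first-argument increments of a copula along the lines of the `m × m` grid sum up to
a Riemann sum for the squared derivative. -/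
theorem IsCopula.tendsto_sum_sq_increments (hC : IsCopula C) :
    Tendsto (fun m : ℕ => ∑ i ∈ Finset.range m, ∑ j ∈ Finset.range m,
      (C (((i : ℝ) + 1) / m) ((j : ℝ) / m) - C ((i : ℝ) / m) ((j : ℝ) / m)) ^ 2) atTop
      (𝓝 (∫ p in Set.Icc (0 : ℝ) 1 ×ˢ Set.Icc (0 : ℝ) 1, (deriv (fun s => C s p.2) p.1) ^ 2)) := by
  rw [hC.integral_deriv_sq_eq]
  have h0 : Tendsto (fun m : ℕ => (∑ j ∈ Finset.range m, gridEnergy C m ((j : ℝ) / m)) / m -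
      ∫ v in (0 : ℝ)..1, gridEnergy C m v) atTop (𝓝 0) := by
    refine squeeze_zero_norm' ?_ tendsto_one_div_atTop_nhds_zero_nat
    filter_upwards [eventually_gt_atTop 0] with m hm
    exact abs_riemann_sub_integral_le (hC.gridEnergy_mono m) (hC.gridEnergy_mem m) hm
  have h1 := h0.add hC.integral_gridEnergy_tendsto
  rw [zero_add] at h1
  refine h1.congr' ?_
  filter_upwards [eventually_gt_atTop 0] with m hm
  have hm' : (0 : ℝ) < m := by exact_mod_cast hm
  rw [sub_add_cancel, Finset.sum_comm, Finset.sum_div]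
  refine Finset.sum_congr rfl fun j hj => ?_
  rw [gridEnergy, Finset.sum_div, Finset.sum_div]
  refine Finset.sum_congr rfl fun i hi => ?_
  have hi' : ((i : ℝ) + 1) ≤ m := by exact_mod_cast Finset.mem_range.1 hi
  have hj' : (j : ℝ) ≤ m := by exact_mod_cast (Finset.mem_range.1 hj).le
  have hv : (j : ℝ) / m ∈ Set.Icc (0 : ℝ) 1 := ⟨by positivity, div_le_one_of_le₀ hj' hm'.le⟩
  rw [copulaExtend_of_mem C ⟨by positivity, div_le_one_of_le₀ hi' hm'.le⟩ hv,
    copulaExtend_of_mem C ⟨by positivity, div_le_one_of_le₀ (by linarith) hm'.le⟩ hv]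
  field_simp

end

/-! ### Quantile sets of the marginal laws -/

theorem cdf_mem_Icc (ν : Measure ℝ) (x : ℝ) : cdf ν x ∈ Set.Icc (0 : ℝ) 1 :=
  ⟨cdf_nonneg ν x, cdf_le_one ν x⟩

/-- If `C (F x) (G y)` is continuous in `x` for each `y`, then so is `F`, its uniform limit as
`G y → 1`. -/
theorem IsCopula.continuous_margin {C : ℝ → ℝ → ℝ} (hC : IsCopula C) {F G : ℝ → ℝ}
    (hF : ∀ x, F x ∈ Set.Icc (0 : ℝ) 1) (hG : ∀ y, G y ∈ Set.Icc (0 : ℝ) 1)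
    (hG1 : Tendsto G atTop (𝓝 1)) (h : ∀ y, Continuous fun x => C (F x) (G y)) : Continuous F := by
  refine continuous_of_uniform_approx_of_continuous fun u hu => ?_
  obtain ⟨ε, hε, hu⟩ := Metric.mem_uniformity_dist.1 hu
  obtain ⟨y, hy⟩ := (hG1.eventually (lt_mem_nhds (show 1 - ε < 1 by linarith))).exists
  refine ⟨fun x => C (F x) (G y), h y, fun x => hu ?_⟩
  have h1 := hC.swap.abs_increment_le (hG y) ⟨zero_le_one, le_rfl⟩ (hF x)
  simp only [hC.margin_left _ (hF x)] at h1
  rw [abs_of_nonneg (sub_nonneg.2 (hG y).2)] at h1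
  rw [Real.dist_eq]
  linarith

theorem IsCopulaOf.continuous_cdf {C : ℝ → ℝ → ℝ} {μ : Measure (ℝ × ℝ)} (h : IsCopulaOf C μ)
    (hμ : Continuous (jointCdf μ)) : Continuous (cdf μ.fst) ∧ Continuous (cdf μ.snd) := by
  constructor
  · refine h.isCopula.continuous_margin (cdf_mem_Icc _) (cdf_mem_Icc μ.snd) (tendsto_cdf_atTop _)
      fun y => ?_
    simp only [← h.sklar]
    fun_prop
  · refine h.isCopula.swap.continuous_margin (cdf_mem_Icc _) (cdf_mem_Icc μ.fst)
      (tendsto_cdf_atTop _) fun y => ?_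
    simp only [← h.sklar]
    fun_prop

/-- A lower set of probability `s` under the law with distribution function `F`. The extreme levels
`0` and `1` need not be values of `F`; there the empty and the full set are taken. -/
def IsQuantileSet (F : ℝ → ℝ) (s : ℝ) (A : Set ℝ) : Prop :=
  (s = 0 ∧ A = ∅) ∨ (s = 1 ∧ A = Set.univ) ∨ (0 < s ∧ s < 1 ∧ ∃ a, F a = s ∧ A = Set.Iic a)

namespace IsQuantileSet

variable {F : ℝ → ℝ} {s : ℝ} {A : Set ℝ}

theorem measurableSet (h : IsQuantileSet F s A) : MeasurableSet A := by
  rcases h with ⟨-, rfl⟩ | ⟨-, rfl⟩ | ⟨-, -, a, -, rfl⟩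
  · exact .empty
  · exact .univ
  · exact measurableSet_Iic

theorem eq_empty (h : IsQuantileSet F 0 A) : A = ∅ := by
  rcases h with ⟨-, h⟩ | ⟨h, -⟩ | ⟨h, -⟩
  · exact h
  · exact absurd h zero_ne_one
  · exact absurd h (lt_irrefl _)

theorem eq_univ (h : IsQuantileSet F 1 A) : A = Set.univ := by
  rcases h with ⟨h, -⟩ | ⟨-, h⟩ | ⟨-, h, -⟩
  · exact absurd h one_ne_zero
  · exact h
  · exact absurd h (lt_irrefl _)

theorem mem_of_lt (h : IsQuantileSet F s A) (hF : Monotone F) (h0 : ∀ x, 0 ≤ F x) {x : ℝ}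
    (hx : F x < s) : x ∈ A := by
  rcases h with ⟨rfl, -⟩ | ⟨-, rfl⟩ | ⟨-, -, a, rfl, rfl⟩
  · exact absurd hx (not_lt.2 (h0 x))
  · trivial
  · by_contra hax
    exact absurd hx (not_lt.2 (hF (not_le.1 hax).le))

theorem le_of_mem (h : IsQuantileSet F s A) (hF : Monotone F) (h1 : ∀ x, F x ≤ 1) {x : ℝ}
    (hx : x ∈ A) : F x ≤ s := by
  rcases h with ⟨-, rfl⟩ | ⟨rfl, -⟩ | ⟨-, -, a, rfl, rfl⟩
  · exact hx.elim
  · exact h1 x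
  · exact hF hx

end IsQuantileSet

theorem exists_isQuantileSet {ν : Measure ℝ} (hν : Continuous (cdf ν)) {s : ℝ}
    (hs : s ∈ Set.Icc (0 : ℝ) 1) : ∃ A, IsQuantileSet (cdf ν) s A := by
  rcases hs.1.eq_or_lt with h0 | h0
  · exact ⟨∅, .inl ⟨h0.symm, rfl⟩⟩
  rcases hs.2.eq_or_lt with h1 | h1
  · exact ⟨Set.univ, .inr (.inl ⟨h1, rfl⟩)⟩
  obtain ⟨a, ha⟩ := mem_range_of_exists_le_of_exists_ge hν
    (((tendsto_cdf_atBot ν).eventually (ge_mem_nhds h0)).exists)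
    (((tendsto_cdf_atTop ν).eventually (le_mem_nhds h1)).exists)
  exact ⟨Set.Iic a, .inr (.inr ⟨h0, h1, a, ha, rfl⟩)⟩

/-- Sklar's identity, extended to the levels `0` and `1`. -/
theorem IsCopulaOf.measureReal_prod {C : ℝ → ℝ → ℝ} {μ : Measure (ℝ × ℝ)} [IsProbabilityMeasure μ]
    (h : IsCopulaOf C μ) {s t : ℝ} {A B : Set ℝ} (hA : IsQuantileSet (cdf μ.fst) s A)
    (hB : IsQuantileSet (cdf μ.snd) t B) : μ.real (A ×ˢ B) = C s t := by
  have hC := h.isCopula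
  have ht : t ∈ Set.Icc (0 : ℝ) 1 := by
    rcases hB with ⟨rfl, -⟩ | ⟨rfl, -⟩ | ⟨h0, h1, -⟩
    · simp
    · simp
    · exact ⟨h0.le, h1.le⟩
  rcases hA with ⟨rfl, rfl⟩ | ⟨rfl, rfl⟩ | ⟨h0, h1, a, rfl, rfl⟩
  · simp [hC.grounded_left t ht]
  · rw [hC.margin_right t ht]
    rcases hB with ⟨rfl, rfl⟩ | ⟨rfl, rfl⟩ | ⟨-, -, b, rfl, rfl⟩
    · simp
    · simp
    · rw [cdf_eq_real, measureReal_def, measureReal_def, Measure.snd_apply measurableSet_Iic,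
        Set.univ_prod]
  · rcases hB with ⟨rfl, rfl⟩ | ⟨rfl, rfl⟩ | ⟨-, -, b, rfl, rfl⟩
    · simp [hC.grounded_right _ (cdf_mem_Icc μ.fst a)]
    · rw [hC.margin_left _ (cdf_mem_Icc μ.fst a), cdf_eq_real, measureReal_def, measureReal_def,
        Measure.fst_apply measurableSet_Iic, Set.prod_univ]
    · exact h.sklar a b

/-! ### Uniform concentration of empirical frequencies -/

section Concentration

variable {Ω 𝓧 : Type*} [MeasurableSpace Ω] [MeasurableSpace 𝓧] {P : Measure Ω}
  [IsProbabilityMeasure P] {μ : Measure 𝓧} {Z : ℕ → Ω → 𝓧}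

/-- **Hoeffding's inequality** for the relative frequency of a set. -/
theorem measureReal_abs_freq_sub_ge_le (hZ : ∀ k, HasLaw (Z k) μ P) (hi : iIndepFun Z P)
    {S : Set 𝓧} (hS : MeasurableSet S) {n : ℕ} (hn : 0 < n) {ε : ℝ} (hε : 0 ≤ ε) :
    P.real {ω | ε ≤ |(∑ k ∈ Finset.range n, S.indicator (1 : 𝓧 → ℝ) (Z k ω)) / n - μ.real S|} ≤
      2 * Real.exp (-2 * n * ε ^ 2) := by
  have hn' : (0 : ℝ) < n := by exact_mod_cast hn
  set g : 𝓧 → ℝ := fun z => S.indicator (1 : 𝓧 → ℝ) z - μ.real S with hg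
  have hgm : Measurable g := (measurable_one.indicator hS).sub_const _
  have hsub : ∀ k, HasSubgaussianMGF (g ∘ Z k) ((‖(1 : ℝ) - 0‖₊ / 2) ^ 2) P := by
    intro k
    have hm : AEMeasurable (fun ω => S.indicator (1 : 𝓧 → ℝ) (Z k ω)) P :=
      (measurable_one.indicator hS).comp_aemeasurable (hZ k).aemeasurable
    have hint : ∫ ω, S.indicator (1 : 𝓧 → ℝ) (Z k ω) ∂P = μ.real S := by
      have := (hZ k).integral_comp (f := S.indicator (1 : 𝓧 → ℝ))
        (measurable_one.indicator hS).aestronglyMeasurable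
      rw [← integral_indicator_one hS, ← this]
      rfl
    have := hasSubgaussianMGF_of_mem_Icc (a := 0) (b := 1) hm (.of_forall fun ω => by
      by_cases h : Z k ω ∈ S <;> simp [h])
    rwa [hint] at this
  have hind : iIndepFun (fun k => g ∘ Z k) P := hi.comp (fun _ => g) fun _ => hgm
  have hind' : iIndepFun (fun k => -(g ∘ Z k)) P := hi.comp (fun _ => -g) fun _ => hgm.neg
  have hexp : -(n * ε) ^ 2 / (2 * n * (((‖(1 : ℝ) - 0‖₊ / 2) ^ 2 : NNReal) : ℝ)) =
      -2 * n * ε ^ 2 := by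
    simp only [sub_zero, nnnorm_one]
    push_cast
    field_simp
  have h1 := HasSubgaussianMGF.measure_sum_range_ge_le_of_iIndepFun hind (n := n)
    (fun k _ => hsub k) (mul_nonneg hn'.le hε)
  have h2 := HasSubgaussianMGF.measure_sum_range_ge_le_of_iIndepFun hind' (n := n)
    (fun k _ => (hsub k).neg) (mul_nonneg hn'.le hε)
  rw [hexp] at h1 h2
  have hsum : ∀ ω, (∑ k ∈ Finset.range n, S.indicator (1 : 𝓧 → ℝ) (Z k ω)) / n - μ.real S =
      (∑ k ∈ Finset.range n, (g ∘ Z k) ω) / n := by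
    intro ω
    simp only [Function.comp, hg, Finset.sum_sub_distrib, Finset.sum_const, Finset.card_range,
      nsmul_eq_mul]
    field_simp
  calc _ ≤ P.real ({ω | n * ε ≤ ∑ k ∈ Finset.range n, (g ∘ Z k) ω} ∪
        {ω | n * ε ≤ ∑ k ∈ Finset.range n, (-(g ∘ Z k)) ω}) := by
        refine measureReal_mono fun ω hω => ?_
        simp only [Set.mem_ofPred_eq, hsum] at hω
        rcases le_abs.1 hω with h | h
        · left
          rw [le_div_iff₀ hn'] at h
          simpa [mul_comm] using h
        · right
          rw [← neg_div, le_div_iff₀ hn'] at h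
          simpa [mul_comm] using h
    _ ≤ _ := (measureReal_union_le _ _).trans (by linarith)

/-- The union bound over `(n + 1)²` sets at the deviation `n ^ (-2/5)` is summable, as the exponent is
`-2 n ^ (1/5)`. -/
theorem summable_exp_tail :
    Summable fun n : ℕ => ((n : ℝ) + 1) ^ 2 * (2 * Real.exp (-2 * n * ((n : ℝ) ^ (-2 / 5 : ℝ)) ^ 2)) := by
  have h1 : (fun n : ℕ => Real.exp (-2 * n * ((n : ℝ) ^ (-2 / 5 : ℝ)) ^ 2)) =O[atTop]
      fun n : ℕ => (n : ℝ) ^ (-4 : ℝ) := by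
    have h := (isLittleO_exp_neg_mul_rpow_atTop (zero_lt_two) (-20)).comp_tendsto
      ((tendsto_rpow_atTop (show (0 : ℝ) < 1 / 5 by norm_num)).comp
        tendsto_natCast_atTop_atTop)
    refine (h.isBigO.congr' ?_ ?_)
    · filter_upwards [eventually_gt_atTop 0] with n hn
      have hn' : (0 : ℝ) < n := by exact_mod_cast hn
      have : (n : ℝ) * ((n : ℝ) ^ (-2 / 5 : ℝ)) ^ 2 = (n : ℝ) ^ (1 / 5 : ℝ) := by
        rw [← Real.rpow_natCast, ← Real.rpow_mul hn'.le, ← Real.rpow_one_add' hn'.le (by norm_num)]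
        norm_num
      simp only [Function.comp]
      rw [mul_assoc, this]
    · filter_upwards [eventually_gt_atTop 0] with n hn
      have hn' : (0 : ℝ) < n := by exact_mod_cast hn
      simp only [Function.comp]
      rw [← Real.rpow_mul hn'.le]
      norm_num
  have h2 : (fun n : ℕ => ((n : ℝ) + 1) ^ 2 * 2) =O[atTop] fun n : ℕ => (n : ℝ) ^ (2 : ℝ) := by
    refine Asymptotics.IsBigO.of_bound 8 ?_
    filter_upwards [eventually_ge_atTop 1] with n hn
    have hn' : (1 : ℝ) ≤ n := by exact_mod_cast hn
    rw [Real.norm_of_nonneg (by positivity), Real.norm_of_nonneg (by positivity), Real.rpow_two]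
    nlinarith
  refine summable_of_isBigO_nat (g := fun n : ℕ => (n : ℝ) ^ (-2 : ℝ))
    (Real.summable_nat_rpow.2 (by norm_num)) ?_
  refine ((h2.mul h1).congr_left fun n => by ring).congr' .rfl ?_
  filter_upwards [eventually_gt_atTop 0] with n hn
  have hn' : (0 : ℝ) < n := by exact_mod_cast hn
  rw [← Real.rpow_add hn']
  norm_num

/-- Almost surely, for large `n` the frequencies of the `(n + 1)²` sets `S n a b` in the first `n`
observations are all within `n ^ (-2/5)` of their probabilities. -/
theorem ae_eventually_abs_freq_sub_lt (hZ : ∀ k, HasLaw (Z k) μ P) (hi : iIndepFun Z P)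
    (S : ℕ → ℕ → ℕ → Set 𝓧) (hS : ∀ n, ∀ a ≤ n, ∀ b ≤ n, MeasurableSet (S n a b)) :
    ∀ᵐ ω ∂P, ∀ᶠ n : ℕ in atTop, ∀ a ≤ n, ∀ b ≤ n,
      |(∑ k ∈ Finset.range n, (S n a b).indicator (1 : 𝓧 → ℝ) (Z k ω)) / n - μ.real (S n a b)| <
        (n : ℝ) ^ (-2 / 5 : ℝ) := by
  set E : ℕ → ℕ → ℕ → Set Ω := fun n a b => {ω | (n : ℝ) ^ (-2 / 5 : ℝ) ≤
    |(∑ k ∈ Finset.range n, (S n a b).indicator (1 : 𝓧 → ℝ) (Z k ω)) / n - μ.real (S n a b)|}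
  set U : ℕ → Set Ω := fun n =>
    ⋃ p ∈ Finset.range (n + 1) ×ˢ Finset.range (n + 1), E n p.1 p.2 with hU
  have hbound : ∀ n : ℕ, 0 < n → P.real (U n) ≤
      ((n : ℝ) + 1) ^ 2 * (2 * Real.exp (-2 * n * ((n : ℝ) ^ (-2 / 5 : ℝ)) ^ 2)) := by
    intro n hn
    calc P.real (U n) ≤ ∑ p ∈ Finset.range (n + 1) ×ˢ Finset.range (n + 1), P.real (E n p.1 p.2) :=
          measureReal_biUnion_finset_le _ _
      _ ≤ ∑ _p ∈ Finset.range (n + 1) ×ˢ Finset.range (n + 1),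
            2 * Real.exp (-2 * n * ((n : ℝ) ^ (-2 / 5 : ℝ)) ^ 2) := by
          refine Finset.sum_le_sum fun p hp => ?_
          rw [Finset.mem_product, Finset.mem_range, Finset.mem_range] at hp
          exact measureReal_abs_freq_sub_ge_le hZ hi (hS n _ (by omega) _ (by omega)) hn
            (by positivity)
      _ = _ := by
          rw [Finset.sum_const, Finset.card_product, Finset.card_range, nsmul_eq_mul]
          push_cast
          ring
  have hsum : Summable fun n => P.real (U n) := by
    refine Summable.of_norm_bounded_eventually_nat summable_exp_tail ?_
    filter_upwards [eventually_gt_atTop 0] with n hn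
    rw [Real.norm_of_nonneg measureReal_nonneg]
    exact hbound n hn
  have htsum : ∑' n, P (U n) ≠ ⊤ := by
    have : ∀ n, P (U n) = ENNReal.ofReal (P.real (U n)) := fun n => by simp
    simp only [this]
    exact hsum.tsum_ofReal_ne_top
  filter_upwards [ae_eventually_notMem htsum] with ω hω
  filter_upwards [hω] with n hn a ha b hb
  by_contra hge
  refine hn (Set.mem_biUnion (x := (a, b)) ?_ (not_lt.1 hge))
  simp only [Finset.coe_product, Set.mem_prod, Finset.mem_coe, Finset.mem_range]
  omega

end Concentration

/-! ### From frequencies of quantile sets to the empirical copula -/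

open Classical in
/-- The relative frequency of the indices with a property. -/
noncomputable def freq {n : ℕ} (p : Fin n → Prop) : ℝ :=
  (∑ k, if p k then (1 : ℝ) else 0) / n

theorem freq_mono {n : ℕ} {p q : Fin n → Prop} (h : ∀ k, p k → q k) : freq p ≤ freq q := by
  unfold freq
  gcongr with k _
  by_cases hp : p k
  · simp [hp, h k hp]
  · simp only [hp, if_false]
    positivity

theorem freq_nonneg {n : ℕ} (p : Fin n → Prop) : 0 ≤ freq p := by
  unfold freq
  positivity

theorem sampleRank_div {n : ℕ} (x : Fin n → ℝ) (k : Fin n) :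
    (sampleRank x k : ℝ) / n = freq fun j => x j ≤ x k := by
  rw [freq, sampleRank, Finset.card_filter]
  push_cast
  congr!

theorem abs_pseudoObs_sub_le {n : ℕ} (hn : 0 < n) (x : Fin n → ℝ) (k : Fin n) :
    |pseudoObs x k - (sampleRank x k : ℝ) / n| ≤ 1 / n := by
  have hn' : (0 : ℝ) < n := by exact_mod_cast hn
  have h1 : (sampleRank x k : ℝ) ≤ n := by exact_mod_cast sampleRank_le x k
  have h0 : (0 : ℝ) ≤ sampleRank x k := Nat.cast_nonneg _
  rw [pseudoObs, abs_sub_comm, abs_of_nonneg (sub_nonneg.2 (by gcongr; linarith)),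
    div_sub_div _ _ hn'.ne' (by positivity), div_le_div_iff₀ (by positivity) hn']
  nlinarith

/-- Quantile sets at the levels `l / N` that approximate the sublevel sets of `F`. -/
structure IsQuantileFamily (F : ℝ → ℝ) (N : ℕ) (A : ℕ → Set ℝ) : Prop where
  mono : Monotone F
  mem : ∀ x, F x ∈ Set.Icc (0 : ℝ) 1
  pos : 0 < N
  quantile : ∀ l ≤ N, IsQuantileSet F ((l : ℝ) / N) (A l)

namespace IsQuantileFamily

variable {F : ℝ → ℝ} {N : ℕ} {A : ℕ → Set ℝ}

/-- A sublevel set `{F < r}` contains a quantile set of a level just below `r`. The second bound is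
relative to a level `s ≥ r` in the unit interval, so that `r` itself may be negative. -/
theorem inner (h : IsQuantileFamily F N A) {r s : ℝ} (hs : s ∈ Set.Icc (0 : ℝ) 1) (hrs : r ≤ s) :
    ∃ l ≤ N, (∀ x ∈ A l, F x < r) ∧ (l : ℝ) / N ≤ s ∧ r - 1 / N ≤ (l : ℝ) / N := by
  have hN : (0 : ℝ) < N := by exact_mod_cast h.pos
  rcases le_or_gt r 0 with hr | hr
  · refine ⟨0, Nat.zero_le _, fun x hx => ?_, by simpa using hs.1, ?_⟩
    · have := (h.quantile 0 (Nat.zero_le _))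
      rw [Nat.cast_zero, zero_div] at this
      rw [this.eq_empty] at hx
      exact hx.elim
    · have : (0 : ℝ) < 1 / N := by positivity
      simp only [Nat.cast_zero, zero_div]
      linarith
  · have hpos : 0 < r * N := by positivity
    obtain ⟨l, hl⟩ : ∃ l, ⌈r * N⌉₊ = l + 1 := Nat.exists_eq_succ_of_ne_zero
      (Nat.ceil_pos.2 hpos).ne'
    have h1 : (l : ℝ) < r * N := Nat.lt_ceil.1 (by omega)
    have h2 : r * N ≤ l + 1 := by
      have := Nat.le_ceil (r * N)
      rw [hl] at this
      exact_mod_cast this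
    have h3 : (l : ℝ) / N < r := by rwa [div_lt_iff₀ hN]
    have hlN : l ≤ N := by
      have : (l : ℝ) ≤ N := by nlinarith [hs.2]
      exact_mod_cast this
    refine ⟨l, hlN, fun x hx => ?_, by linarith, ?_⟩
    · exact ((h.quantile l hlN).le_of_mem h.mono (fun x => (h.mem x).2) hx).trans_lt h3
    · rw [sub_le_iff_le_add, ← add_div, le_div_iff₀ hN]
      exact h2

/-- A sublevel set `{F ≤ r}` is contained in a quantile set of a level just above `r`, or of level
`1` if `r ≥ 1`. -/
theorem outer (h : IsQuantileFamily F N A) {r s : ℝ} (hs : s ∈ Set.Icc (0 : ℝ) 1) (hrs : s ≤ r) :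
    ∃ l ≤ N, (∀ x, F x ≤ r → x ∈ A l) ∧ s ≤ (l : ℝ) / N ∧ (l : ℝ) / N ≤ r + 1 / N := by
  have hN : (0 : ℝ) < N := by exact_mod_cast h.pos
  rcases le_or_gt 1 r with hr | hr
  · have := h.quantile N le_rfl
    rw [div_self hN.ne'] at this
    refine ⟨N, le_rfl, fun x _ => this.eq_univ ▸ trivial, by rw [div_self hN.ne']; exact hs.2, ?_⟩
    rw [div_self hN.ne']
    have : (0 : ℝ) < 1 / N := by positivity
    linarith
  · have h0 : 0 ≤ r * N := mul_nonneg (hs.1.trans hrs) hN.le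
    have h1 := Nat.floor_le h0
    have h2 := Nat.lt_floor_add_one (r * N)
    have h3 : r < ((⌊r * N⌋₊ + 1 : ℕ) : ℝ) / N := by
      rw [lt_div_iff₀ hN]
      exact_mod_cast h2
    have hlN : ⌊r * N⌋₊ + 1 ≤ N := (Nat.floor_lt h0).2 (by nlinarith)
    refine ⟨⌊r * N⌋₊ + 1, hlN, fun x hx => ?_, by linarith, ?_⟩
    · exact (h.quantile _ hlN).mem_of_lt h.mono (fun x => (h.mem x).1) (hx.trans_lt h3)
    · rw [← sub_le_iff_le_add, ← sub_div, div_le_iff₀ hN]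
      push_cast
      linarith

theorem eq_univ (h : IsQuantileFamily F N A) : A N = Set.univ := by
  have hN : (N : ℝ) ≠ 0 := by exact_mod_cast h.pos.ne'
  have := h.quantile N le_rfl
  rw [div_self hN] at this
  exact this.eq_univ

/-- Normalized ranks are close to the values of the distribution function. -/
theorem abs_pseudoObs_sub_le (h : IsQuantileFamily F N A) {n : ℕ} (hn : 0 < n) (x : Fin n → ℝ)
    {ε : ℝ} (hε : ∀ l ≤ N, |freq (fun k => x k ∈ A l) - (l : ℝ) / N| ≤ ε) (k : Fin n) :
    |pseudoObs x k - F (x k)| ≤ ε + 1 / N + 1 / n := by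
  have h1 := _root_.abs_pseudoObs_sub_le hn x k
  have h2 : |(sampleRank x k : ℝ) / n - F (x k)| ≤ ε + 1 / N := by
    rw [sampleRank_div, abs_le]
    constructor
    · obtain ⟨l, hl, hA, -, hr⟩ := h.inner (h.mem (x k)) le_rfl
      have e := (abs_le.1 (hε l hl)).1
      have m : freq (fun j => x j ∈ A l) ≤ freq fun j => x j ≤ x k :=
        freq_mono fun j hj => (h.mono.reflect_lt (hA _ hj)).le
      linarith
    · obtain ⟨l, hl, hA, -, hr⟩ := h.outer (h.mem (x k)) le_rfl
      have e := (abs_le.1 (hε l hl)).2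
      have m : (freq fun j => x j ≤ x k) ≤ freq (fun j => x j ∈ A l) :=
        freq_mono fun j hj => hA _ (h.mono hj)
      linarith
  calc |pseudoObs x k - F (x k)|
      = |(pseudoObs x k - (sampleRank x k : ℝ) / n) + ((sampleRank x k : ℝ) / n - F (x k))| := by
        ring_nf
    _ ≤ _ := (abs_add_le _ _).trans (by linarith)

end IsQuantileFamily

/-- The empirical copula of the normalized ranks. The inequalities are strict, to match the half-open
grid squares. -/
noncomputable def empiricalCopula {n : ℕ} (x y : Fin n → ℝ) (s t : ℝ) : ℝ :=
  freq fun k => pseudoObs x k < s ∧ pseudoObs y k < t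

/-- Replacing normalized ranks by values of the distribution functions shifts the arguments by at most
`ε + 1 / N + 1 / n`, and rounding to the levels of the quantile sets by another `1 / N`. -/
theorem abs_empiricalCopula_sub_le {C : ℝ → ℝ → ℝ} (hC : IsCopula C) {F G : ℝ → ℝ} {N : ℕ}
    {A B : ℕ → Set ℝ} (hA : IsQuantileFamily F N A) (hB : IsQuantileFamily G N B)
    {n : ℕ} (hn : 0 < n) (x y : Fin n → ℝ) {ε : ℝ} (hε0 : 0 ≤ ε)
    (hε : ∀ a ≤ N, ∀ b ≤ N, |freq (fun k => x k ∈ A a ∧ y k ∈ B b) - C ((a : ℝ) / N) ((b : ℝ) / N)|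
      ≤ ε)
    {s t : ℝ} (hs : s ∈ Set.Icc (0 : ℝ) 1) (ht : t ∈ Set.Icc (0 : ℝ) 1) :
    |empiricalCopula x y s t - C s t| ≤ 3 * ε + 4 / N + 2 / n := by
  have hN : (0 : ℝ) < N := by exact_mod_cast hA.pos
  have hn' : (0 : ℝ) < n := by exact_mod_cast hn
  have unit : ∀ l ≤ N, (l : ℝ) / N ∈ Set.Icc (0 : ℝ) 1 := fun l hl =>
    ⟨by positivity, div_le_one_of_le₀ (by exact_mod_cast hl) hN.le⟩
  set η := ε + 1 / N + 1 / n with hη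
  have hη0 : 0 ≤ η := by positivity
  have hx : ∀ k, |pseudoObs x k - F (x k)| ≤ η := hA.abs_pseudoObs_sub_le hn x fun l hl => by
    have := hε l hl N le_rfl
    simpa [hB.eq_univ, div_self hN.ne', hC.margin_left _ (unit l hl)] using this
  have hy : ∀ k, |pseudoObs y k - G (y k)| ≤ η := hB.abs_pseudoObs_sub_le hn y fun l hl => by
    have := hε N le_rfl l hl
    simpa [hA.eq_univ, div_self hN.ne', hC.margin_right _ (unit l hl)] using this
  have hδ : 3 * ε + 4 / N + 2 / n = ε + (η + 1 / N) + (η + 1 / N) := by rw [hη]; ring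
  rw [hδ, abs_le]
  constructor
  · obtain ⟨a, ha, hA', ha1, ha2⟩ := hA.inner hs (show s - η ≤ s by linarith)
    obtain ⟨b, hb, hB', hb1, hb2⟩ := hB.inner ht (show t - η ≤ t by linarith)
    have e := (abs_le.1 (hε a ha b hb)).1
    have m : freq (fun k => x k ∈ A a ∧ y k ∈ B b) ≤ empiricalCopula x y s t :=
      freq_mono fun k hk => by
        have h1 := (abs_le.1 (hx k)).2
        have h2 := (abs_le.1 (hy k)).2
        have h3 := hA' _ hk.1
        have h4 := hB' _ hk.2
        constructor <;> linarith
    have l := (abs_le.1 (hC.abs_sub_le hs (unit a ha) ht (unit b hb))).1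
    rw [abs_of_nonpos (sub_nonpos.2 ha1), abs_of_nonpos (sub_nonpos.2 hb1)] at l
    linarith
  · obtain ⟨a, ha, hA', ha1, ha2⟩ := hA.outer hs (show s ≤ s + η by linarith)
    obtain ⟨b, hb, hB', hb1, hb2⟩ := hB.outer ht (show t ≤ t + η by linarith)
    have e := (abs_le.1 (hε a ha b hb)).2
    have m : empiricalCopula x y s t ≤ freq (fun k => x k ∈ A a ∧ y k ∈ B b) :=
      freq_mono fun k hk => by
        have h1 := (abs_le.1 (hx k)).1
        have h2 := (abs_le.1 (hy k)).1
        exact ⟨hA' _ (by linarith [hk.1]), hB' _ (by linarith [hk.2])⟩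
    have l := (abs_le.1 (hC.abs_sub_le hs (unit a ha) ht (unit b hb))).2
    rw [abs_of_nonneg (sub_nonneg.2 ha1), abs_of_nonneg (sub_nonneg.2 hb1)] at l
    linarith

/-! ### Stability of the quadratic form -/

/-- The estimator is determined by the increments of the row sums up to small terms: if the row sums
of a nonnegative matrix `d` are increments of `E`, and `E` is within `δ` of `G`, whose increments in
the first argument lie between `0` and `1 / m`, then only the squared increments of `G` survive. -/
theorem abs_sum_xiTerm_sub_le {m : ℕ} (hm : 0 < m) {d E G : ℕ → ℕ → ℝ} {δ : ℝ} (hδ : 0 ≤ δ)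
    (hd : ∀ i < m, ∀ j < m, 0 ≤ d i j)
    (hE : ∀ i < m, ∀ j ≤ m, ∑ l ∈ Finset.range j, d i l = E (i + 1) j - E i j)
    (hEG : ∀ i ≤ m, ∀ j ≤ m, |E i j - G i j| ≤ δ)
    (hG : ∀ i < m, ∀ j ≤ m, G (i + 1) j - G i j ∈ Set.Icc 0 (1 / (m : ℝ))) :
    |(∑ i ∈ Finset.range m, ∑ j ∈ Finset.range m, xiTerm (∑ l ∈ Finset.range j, d i l) (d i j)) -
      6 * ∑ i ∈ Finset.range m, ∑ j ∈ Finset.range m, (G (i + 1) j - G i j) ^ 2| ≤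
      24 * (m * δ) + 24 * (m * δ) ^ 2 + 9 * (1 + 2 * (m * δ)) ^ 2 * (1 / m) := by
  have hm' : (0 : ℝ) < m := by exact_mod_cast hm
  set R : ℝ := 1 / m + 2 * δ with hR
  have hR0 : 0 ≤ R := by positivity
  have hS : ∀ i < m, ∀ j ≤ m, |(∑ l ∈ Finset.range j, d i l) - (G (i + 1) j - G i j)| ≤ 2 * δ := by
    intro i hi j hj
    have h1 := abs_le.1 (hEG (i + 1) hi j hj)
    have h2 := abs_le.1 (hEG i hi.le j hj)
    rw [hE i hi j hj, abs_le]
    constructor <;> linarith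
  have hSR : ∀ i < m, ∀ j ≤ m, ∑ l ∈ Finset.range j, d i l ≤ R := by
    intro i hi j hj
    have h1 := (abs_le.1 (hS i hi j hj)).2
    have h2 := (hG i hi j hj).2
    linarith
  have hS0 : ∀ i < m, ∀ j ≤ m, 0 ≤ ∑ l ∈ Finset.range j, d i l := fun i hi j hj =>
    Finset.sum_nonneg fun l hl => hd i hi l (by have := Finset.mem_range.1 hl; omega)
  have term : ∀ i < m, ∀ j < m, |xiTerm (∑ l ∈ Finset.range j, d i l) (d i j) -
      6 * (G (i + 1) j - G i j) ^ 2| ≤ 12 * δ * (2 / m + 2 * δ) + 9 * R * d i j := by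
    intro i hi j hj
    have h1 := abs_le.1 (hS i hi j hj.le)
    have h2 := hG i hi j hj.le
    have h3 := hSR i hi j hj.le
    have h4 := hS0 i hi j hj.le
    have h5 := hd i hi j hj
    have h6 : d i j ≤ R := by
      have h := hSR i hi (j + 1) hj
      rw [Finset.sum_range_succ] at h
      linarith
    set s := ∑ l ∈ Finset.range j, d i l
    set g := G (i + 1) j - G i j
    have hq : |s ^ 2 - g ^ 2| ≤ 2 * δ * (2 / m + 2 * δ) := by
      have : s ^ 2 - g ^ 2 = (s - g) * (s + g) := by ring
      rw [this, abs_mul]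
      have e : |s + g| ≤ 2 / m + 2 * δ := by
        rw [abs_of_nonneg (add_nonneg h4 h2.1)]
        have : (2 : ℝ) / m = 1 / m + 1 / m := by ring
        linarith [h2.2]
      exact mul_le_mul (abs_le.2 h1) e (abs_nonneg _) (by positivity)
    have hsd : s * d i j ≤ R * d i j := mul_le_mul_of_nonneg_right h3 h5
    have hdd : d i j * d i j ≤ R * d i j := mul_le_mul_of_nonneg_right h6 h5
    have hsd0 : 0 ≤ s * d i j := mul_nonneg h4 h5
    have hdd0 : 0 ≤ d i j * d i j := mul_nonneg h5 h5
    rw [abs_le] at hq ⊢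
    unfold xiTerm
    constructor <;> nlinarith
  rw [Finset.mul_sum, ← Finset.sum_sub_distrib]
  simp only [Finset.mul_sum, ← Finset.sum_sub_distrib]
  calc _ ≤ ∑ i ∈ Finset.range m, (m * (12 * δ * (2 / m + 2 * δ)) + 9 * R * R) := by
        refine (Finset.abs_sum_le_sum_abs _ _).trans (Finset.sum_le_sum fun i hi => ?_)
        have hi' := Finset.mem_range.1 hi
        refine (Finset.abs_sum_le_sum_abs _ _).trans ((Finset.sum_le_sum fun j hj =>
          term i hi' j (Finset.mem_range.1 hj)).trans ?_)
        rw [Finset.sum_add_distrib, Finset.sum_const, ← Finset.mul_sum, Finset.card_range,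
          nsmul_eq_mul]
        have := mul_le_mul_of_nonneg_left (hSR i hi' m le_rfl) (show 0 ≤ 9 * R by positivity)
        linarith
    _ = _ := by
        rw [Finset.sum_const, Finset.card_range, nsmul_eq_mul, hR]
        field_simp
        ring

/-! ### Consistency -/

/-- The row sums of the empirical checkerboard matrix are increments of the empirical copula. -/
theorem sum_checkerboard_row {n m : ℕ} (hm : 0 < m) (x y : Fin n → ℝ) (i j : ℕ) :
    ∑ l ∈ Finset.range j, freq (fun k => pseudoObs x k ∈ Set.Ico ((i : ℝ) / m) (((i : ℝ) + 1) / m) ∧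
        pseudoObs y k ∈ Set.Ico ((l : ℝ) / m) (((l : ℝ) + 1) / m)) =
      empiricalCopula x y (((i + 1 : ℕ) : ℝ) / m) ((j : ℝ) / m) -
        empiricalCopula x y ((i : ℝ) / m) ((j : ℝ) / m) := by
  have hm' : (0 : ℝ) < m := by exact_mod_cast hm
  induction j with
  | zero =>
    have h0 : ∀ s, empiricalCopula x y s (((0 : ℕ) : ℝ) / m) = 0 := by
      intro s
      have : ∀ k, ¬ pseudoObs y k < 0 := fun k => not_lt.2 (by unfold pseudoObs; positivity)
      simp [empiricalCopula, freq, this]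
    rw [Finset.sum_range_zero, h0, h0, sub_zero]
  | succ j ih =>
    rw [Finset.sum_range_succ, ih]
    simp only [empiricalCopula, freq, ← sub_div, ← add_div, ← Finset.sum_sub_distrib,
      ← Finset.sum_add_distrib]
    congr 1
    refine Finset.sum_congr rfl fun k _ => ?_
    have hi : (i : ℝ) / m < ((i : ℝ) + 1) / m := by gcongr; linarith
    have hj : (j : ℝ) / m < ((j : ℝ) + 1) / m := by gcongr; linarith
    push_cast
    simp only [Set.mem_Ico]
    -- Inclusion-exclusion for the indicator of a rectangle.
    by_cases h1 : pseudoObs x k < (i : ℝ) / m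
    · simp [h1, h1.trans hi, not_le.2 h1]
    · by_cases h2 : pseudoObs y k < (j : ℝ) / m
      · simp [h1, h2, h2.trans hj, not_le.2 h2, not_lt.1 h1]
      · simp [h1, h2, not_lt.1 h1, not_lt.1 h2]

theorem empiricalCheckerboard_eq_freq {n m : ℕ} (x y : Fin n → ℝ) (i j : Fin m) :
    empiricalCheckerboard m x y i j =
      freq (fun k => pseudoObs x k ∈ Set.Ico ((i : ℝ) / m) (((i : ℝ) + 1) / m) ∧
        pseudoObs y k ∈ Set.Ico ((j : ℝ) / m) (((j : ℝ) + 1) / m)) := by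
  rw [empiricalCheckerboard, Matrix.of_apply, one_div, inv_mul_eq_div, freq]
  congr 1

/-- The estimator compared with the squared increments of `C`, in terms of the uniform distance `δ`
of `C` and the empirical copula. -/
theorem abs_xiOfMatrix_sub_le {C : ℝ → ℝ → ℝ} (hC : IsCopula C) {n m : ℕ} (hm : 0 < m)
    (x y : Fin n → ℝ) {δ : ℝ}
    (hδ : ∀ s ∈ Set.Icc (0 : ℝ) 1, ∀ t ∈ Set.Icc (0 : ℝ) 1, |empiricalCopula x y s t - C s t| ≤ δ) :
    |xiOfMatrix (empiricalCheckerboard m x y) - (6 * (∑ i ∈ Finset.range m, ∑ j ∈ Finset.range m,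
      (C (((i : ℝ) + 1) / m) ((j : ℝ) / m) - C ((i : ℝ) / m) ((j : ℝ) / m)) ^ 2) - 2)| ≤
      24 * (m * δ) + 24 * (m * δ) ^ 2 + 9 * (1 + 2 * (m * δ)) ^ 2 * (1 / m) := by
  have hm' : (0 : ℝ) < m := by exact_mod_cast hm
  have unit : ∀ l ≤ m, (l : ℝ) / m ∈ Set.Icc (0 : ℝ) 1 := fun l hl =>
    ⟨by positivity, div_le_one_of_le₀ (by exact_mod_cast hl) hm'.le⟩
  have hδ0 : 0 ≤ δ := (abs_nonneg _).trans (hδ 0 (by simp) 0 (by simp))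
  rw [xiOfMatrix_eq_sum _ (fun i j : ℕ => freq fun k =>
      pseudoObs x k ∈ Set.Ico ((i : ℝ) / m) (((i : ℝ) + 1) / m) ∧
        pseudoObs y k ∈ Set.Ico ((j : ℝ) / m) (((j : ℝ) + 1) / m))
    (empiricalCheckerboard_eq_freq x y), sub_sub_sub_cancel_right]
  have h := abs_sum_xiTerm_sub_le hm (E := fun i j => empiricalCopula x y ((i : ℝ) / m) ((j : ℝ) / m))
    (G := fun i j => C ((i : ℝ) / m) ((j : ℝ) / m)) hδ0 (fun i _ j _ => freq_nonneg _)
    (fun i _ j _ => sum_checkerboard_row hm x y i j)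
    (fun i hi j hj => hδ _ (unit i hi) _ (unit j hj)) (fun i hi j hj => by
      have hle : (i : ℝ) / m ≤ ((i + 1 : ℕ) : ℝ) / m := by push_cast; gcongr; linarith
      refine ⟨hC.increment_nonneg (unit i hi.le).1 hle (unit _ hi).2 (unit j hj).1 (unit j hj).2,
        (hC.increment_le (unit i hi.le).1 hle (unit _ hi).2 (unit j hj).1 (unit j hj).2).trans_eq ?_⟩
      push_cast
      ring)
  simpa only [Nat.cast_add, Nat.cast_one] using h

theorem tendsto_gridSize {κ : ℝ} (hκ : 0 < κ) :
    Tendsto (fun n : ℕ => ⌊(n : ℝ) ^ κ⌋₊) atTop atTop :=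
  tendsto_nat_floor_atTop.comp ((tendsto_rpow_atTop hκ).comp tendsto_natCast_atTop_atTop)

/-- The exponent `1 / 3` keeps the grid coarse compared with the rate `n ^ (-2/5)`. -/
theorem tendsto_gridSize_mul_error {κ : ℝ} (hκ : κ ≤ 1 / 3) :
    Tendsto (fun n : ℕ => (⌊(n : ℝ) ^ κ⌋₊ : ℝ) *
      (3 * (n : ℝ) ^ (-2 / 5 : ℝ) + 4 / n + 2 / n)) atTop (𝓝 0) := by
  have h1 : Tendsto (fun n : ℕ => 9 * (n : ℝ) ^ (-(1 / 15) : ℝ)) atTop (𝓝 0) := by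
    simpa using ((tendsto_rpow_neg_atTop (show (0 : ℝ) < 1 / 15 by norm_num)).comp
      tendsto_natCast_atTop_atTop).const_mul 9
  refine squeeze_zero' (.of_forall fun n => by positivity) ?_ h1
  filter_upwards [eventually_ge_atTop 1] with n hn
  have hn' : (1 : ℝ) ≤ n := by exact_mod_cast hn
  have e1 : (⌊(n : ℝ) ^ κ⌋₊ : ℝ) ≤ (n : ℝ) ^ (1 / 3 : ℝ) :=
    (Nat.floor_le (by positivity)).trans (Real.rpow_le_rpow_of_exponent_le hn' hκ)
  have e2 : (1 : ℝ) / n ≤ (n : ℝ) ^ (-2 / 5 : ℝ) := by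
    rw [one_div, ← Real.rpow_neg_one]
    exact Real.rpow_le_rpow_of_exponent_le hn' (by norm_num)
  calc _ ≤ (n : ℝ) ^ (1 / 3 : ℝ) * (9 * (n : ℝ) ^ (-2 / 5 : ℝ)) := by
        refine mul_le_mul e1 ?_ (by positivity) (by positivity)
        have : (4 : ℝ) / n + 2 / n = 6 * (1 / n) := by ring
        linarith
    _ = 9 * (n : ℝ) ^ (-(1 / 15) : ℝ) := by
        rw [mul_left_comm, ← Real.rpow_add (by linarith)]
        norm_num

theorem ae_tendsto_xiEstimator {κ : ℝ} (hκ₀ : 0 < κ) (hκ : κ ≤ 1 / 3) {Ω : Type*}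
    [MeasurableSpace Ω] {P : Measure Ω} [IsProbabilityMeasure P] {μ : Measure (ℝ × ℝ)}
    [IsProbabilityMeasure μ] {X Y : ℕ → Ω → ℝ} {C : ℝ → ℝ → ℝ} (hμ : Continuous (jointCdf μ))
    (hlaw : ∀ k, HasLaw (fun ω => (X k ω, Y k ω)) μ P)
    (hind : iIndepFun (fun k ω => (X k ω, Y k ω)) P) (hC : IsCopulaOf C μ) :
    ∀ᵐ ω ∂P, Tendsto
      (fun n : ℕ => xiEstimator κ (fun k : Fin n => X k ω) (fun k : Fin n => Y k ω))
      atTop (𝓝 (chatterjeeXi C)) := by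
  obtain ⟨hF, hG⟩ := hC.continuous_cdf hμ
  have unit : ∀ n l : ℕ, l ≤ n → (l : ℝ) / n ∈ Set.Icc (0 : ℝ) 1 := fun n l hl =>
    ⟨by positivity, div_le_one_of_le₀ (by exact_mod_cast hl) (Nat.cast_nonneg n)⟩
  have hA : ∀ n l : ℕ, ∃ A, l ≤ n → IsQuantileSet (cdf μ.fst) ((l : ℝ) / n) A := fun n l => by
    by_cases hl : l ≤ n
    · obtain ⟨A, hA⟩ := exists_isQuantileSet hF (unit n l hl)
      exact ⟨A, fun _ => hA⟩
    · exact ⟨∅, fun h => absurd h hl⟩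
  have hB : ∀ n l : ℕ, ∃ B, l ≤ n → IsQuantileSet (cdf μ.snd) ((l : ℝ) / n) B := fun n l => by
    by_cases hl : l ≤ n
    · obtain ⟨B, hB⟩ := exists_isQuantileSet hG (unit n l hl)
      exact ⟨B, fun _ => hB⟩
    · exact ⟨∅, fun h => absurd h hl⟩
  choose A hA using hA
  choose B hB using hB
  filter_upwards [ae_eventually_abs_freq_sub_lt hlaw hind (fun n a b => A n a ×ˢ B n b)
    fun n a ha b hb => (hA n a ha).measurableSet.prod (hB n b hb).measurableSet] with ω hω
  have hm := tendsto_gridSize hκ₀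
  have herr := tendsto_gridSize_mul_error hκ
  have hmain := ((hC.isCopula.tendsto_sum_sq_increments.comp hm).const_mul 6).sub_const 2
  refine (tendsto_iff_of_dist ?_).2 hmain
  have hbound : Tendsto (fun n : ℕ =>
      24 * ((⌊(n : ℝ) ^ κ⌋₊ : ℝ) * (3 * (n : ℝ) ^ (-2 / 5 : ℝ) + 4 / n + 2 / n)) +
      24 * ((⌊(n : ℝ) ^ κ⌋₊ : ℝ) * (3 * (n : ℝ) ^ (-2 / 5 : ℝ) + 4 / n + 2 / n)) ^ 2 +
      9 * (1 + 2 * ((⌊(n : ℝ) ^ κ⌋₊ : ℝ) * (3 * (n : ℝ) ^ (-2 / 5 : ℝ) + 4 / n + 2 / n))) ^ 2 *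
        (1 / (⌊(n : ℝ) ^ κ⌋₊ : ℝ))) atTop (𝓝 0) := by
    have := ((herr.const_mul 24).add ((herr.pow 2).const_mul 24)).add
      (((((herr.const_mul 2).const_add 1).pow 2).const_mul 9).mul
        (tendsto_one_div_atTop_nhds_zero_nat.comp hm))
    simpa using this
  refine squeeze_zero' (.of_forall fun n => dist_nonneg) ?_ hbound
  filter_upwards [hω, eventually_ge_atTop 1] with n hn hn1
  rw [Real.dist_eq]
  refine abs_xiOfMatrix_sub_le hC.isCopula (one_le_gridSize hκ₀.le hn1) _ _ fun s hs t ht => ?_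
  refine abs_empiricalCopula_sub_le hC.isCopula (F := cdf μ.fst) (G := cdf μ.snd) (A := A n)
    (B := B n) ⟨monotone_cdf _, cdf_mem_Icc _, hn1, hA n⟩ ⟨monotone_cdf _, cdf_mem_Icc _, hn1, hB n⟩
    hn1 _ _ (by positivity) (fun a ha b hb => ?_) hs ht
  have h := (hn a ha b hb).le
  rw [hC.measureReal_prod (hA n a ha) (hB n b hb)] at h
  have e : freq (fun k : Fin n => X k ω ∈ A n a ∧ Y k ω ∈ B n b) = (∑ k ∈ Finset.range n,
      (A n a ×ˢ B n b).indicator (1 : ℝ × ℝ → ℝ) (X k ω, Y k ω)) / n := by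
    rw [freq, Finset.sum_range]
    congr 1
  rw [e]
  exact h

theorem theorem4p3 (κ : ℝ) (hκ₀ : 0 ≤ κ) (hκ : κ ≤ 1 / 3) :
    (∃ (p : Prog) (T : ℕ → ℕ),
      ((fun n => (T n : ℝ)) =O[atTop] fun n : ℕ => (n : ℝ) * Real.log n) ∧
      ∀ (n : ℕ), 1 ≤ n → ∀ x y : Fin n → ℝ,
        Computes p (initStore κ x y) (T n) (xiEstimator κ x y)) ∧
    (0 < κ →
      ∀ (Ω : Type u) [MeasurableSpace Ω] (P : Measure Ω) [IsProbabilityMeasure P]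
        (μ : Measure (ℝ × ℝ)) [IsProbabilityMeasure μ] (X Y : ℕ → Ω → ℝ) (C : ℝ → ℝ → ℝ),
        Continuous (jointCdf μ) →
        (∀ k, HasLaw (fun ω => (X k ω, Y k ω)) μ P) →
        iIndepFun (fun k ω => (X k ω, Y k ω)) P →
        IsCopulaOf C μ →
        ∀ᵐ ω ∂P, Tendsto
          (fun n : ℕ => xiEstimator κ (fun k : Fin n => X k ω) (fun k : Fin n => Y k ω))
          atTop (𝓝 (chatterjeeXi C))) := by
  refine ⟨⟨xiProg, fun n => 1000 * (n * (Nat.clog 2 n + 1)), isBigO_clog, fun n hn x y =>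
    runs_xiProg hκ₀ hκ hn x y⟩, ?_⟩
  intro hκ₁ Ω _ P _ μ _ X Y C hμ hlaw hind hC
  exact ae_tendsto_xiEstimator hκ₁ hκ hμ hlaw hind hC
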